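/- **Conventions.** Let $m=(m(n))_{n\ge 0}$ be a sequence of positive reals with $m(0)=1$. For a formal series put $\partial_{m,t}\sum_n a_nt^n:=\sum_n\frac{m(n+1)}{m(n)}a_{n+1}t^n$ and $\mathcal B_{m,t}\sum_n a_nt^n:=\sum_n\frac{a_n}{m(n)}t^n$. A series $\sum a_nt^n$ over a Banach space $\mathbb E$ is *Gevrey of order $s\in\mathbb R$* if $\|a_n\|\le BC^n(n!)^s$ for some $B,C<\infty$ and all $n$; $m$ *preserves Gevrey order* if for all $s\in\mathbb R$, all complex Banach spaces $\mathbb E$ and all $\hat u\in\mathbb E[[t]]$, $\hat u$ is Gevrey of order $s$ iff $\mathcal B_{m,t}\hat u$ is. $D$ denotes a disc centred at $0$ whose radius is not specified, $\mathcal O_{1/\kappa}(D)$ the holomorphic functions of $z^{1/\kappa}$ on $D$; a series in $\mathcal O_{1/\kappa}(D)[[t]]$ is Gevrey of order $s$ with respect to $t$ if it is so over the space of functions in $\mathcal O_{1/\kappa}(D)$ continuous on $\overline D$ with the sup norm, for some disc $D$. $\mathcal O^k(\mathbb C)$ is the set of entire $\varphi$ with $|\varphi(z)|<Ae^{B|z|^k}$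 for some $A,B>0$. *Symbols.* A symbol is a holomorphic function $\lambda(\zeta)$ of $\xi=\zeta^{1/\kappa}$ near $\zeta=\infty$ with at most a pole at infinity, $\lambda(\zeta)=\sum_{j\ge -N}a_j\zeta^{-j/\kappa}$. It acts on formal sums $\sum_{b\ge -M}c_be_b$, where $e_b$ stands for $z^{b/\kappa}/\Gamma(1+b/\kappa)$, by $\lambda(\partial_z)e_b=\sum_ja_je_{b+j}$; thus products of symbols correspond to compositions of operators. A holomorphic germ $\varphi$ is identified with $\sum_n\varphi^{(n)}(0)e_{\kappa n}$. The regular part of such a sum is the function $\sum_{b\ge 0}c_bz^{b/\kappa}/\Gamma(1+b/\kappa)$. A series $\hat w=\sum_n w_n t^n\in\mathcal O_{1/\kappa}(D)[[t]]$ is called a formal solution of a pseudodifferential Cauchy problem $T(\partial_{m,t},\partial_z)w=0$, $\partial_{m,t}^\beta w(0,z)=g_\beta$ ($0\le\beta<N$), if there is a series in $t$ whose coefficients are such formal sums, which satisfies the equation and the initial conditions, and whose coefficients have the regular parts $w_n$. *The problem.* Let $P(\lambda,\zeta)\neq 0$ be a polynomial of degree $p$ in $\lambda$ with leading coefficient $P_0(\zeta)$,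 and let, near $\zeta=\infty$, $$P(\lambda,\zeta)=P_0(\zeta)\prod_{j=1}^n\prod_{l=1}^{p_j}(\lambda-\lambda_{jl}(\zeta))^{p_{jl}},\qquad p_{jl}\ge 1,$$ where the $\lambda_{jl}$ are pairwise distinct symbols, holomorphic in $\zeta^{1/\kappa}$ for a common integer $\kappa\ge1$, with $\lambda_{jl}(\zeta)\sim\lambda_{jl}\zeta^{q_j}$ as $\zeta\to\infty$, $\lambda_{jl}\in\mathbb C\setminus\{0\}$, $q_j\in\mathbb Q$. For $\varphi_0,\dots,\varphi_{p-1}\in\mathcal O(D)$, a series $\hat u\in\mathcal O(D)[[t]]$ is a *normalised formal solution* of $$P(\partial_{m,t},\partial_z)u=0,\qquad \partial_{m,t}^ju(0,z)=\varphi_j(z)\quad(j=0,\dots,p-1)\tag{1}$$ if it satisfies (1) and is also a formal solution of $\prod_{j}\prod_l(\partial_{m,t}-\lambda_{jl}(\partial_z))^{p_{jl}}u=0$ with the same initial data. **Theorem.** There are symbols $d_{jl\alpha\beta}(\zeta)$ ($1\le j\le n$, $1\le l\le p_j$, $1\le\alpha\le p_{jl}$, $0\le\beta<p$), holomorphic functions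 of $\zeta^{1/\kappa}$ of moderate growth near infinity and depending only on the factorised polynomial, such that the following holds for every $m$ that preserves Gevrey order, all $\varphi_0,\dots,\varphi_{p-1}\in\mathcal O(D)$ and every normalised formal solution $\hat u$ of (1). One has $$\hat u=\sum_{j=1}^n\sum_{l=1}^{p_j}\sum_{\alpha=1}^{p_{jl}}\hat u_{jl\alpha},\qquad \hat u_{jl\alpha}\in\mathcal O_{1/\kappa}(D)[[t]],$$ where $\hat u_{jl\alpha}$ is a formal solution of $$(\partial_{m,t}-\lambda_{jl}(\partial_z))^\alpha u=0,\quad \partial_{m,t}^\beta u(0,z)=0\ (0\le\beta\le\alpha-2),\quad \partial_{m,t}^{\alpha-1}u(0,z)=\lambda_{jl}^{\alpha-1}(\partial_z)\varphi_{jl\alpha},$$ with $\varphi_{jl\alpha}:=\sum_{\beta=0}^{p-1}d_{jl\alpha\beta}(\partial_z)\varphi_\beta$. Moreover, each $\hat u_{jl\alpha}$ is Gevrey of order $\max\{q_j,0\}$ with respect to $t$. If in addition $\varphi_0,\dots,\varphi_{p-1}\in\mathcal O^k(\mathbb C)$ for some $k>0$, then each $\hat u_{jl\alpha}$ is Gevrey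 of order $\max\{q_j,0\}\cdot\max\{1-1/k,0\}$ with respect to $t$; that is, of order $\max\{q_j,0\}(1-1/k)$ when $k\ge 1$. -/

import Mathlib

open Filter Topology Polynomial

noncomputable section

namespace MomentPDE

/-! ### Formal power series in `t`

A formal power series `∑ aₙ tⁿ` with coefficients in `V` is given by its coefficient sequence
`a : ℕ → V`. -/

/-- `∑ aₙ tⁿ` has Gevrey order `s`: `‖aₙ‖ ≤ B Cⁿ (n!)^s`. -/
def IsGevrey {E : Type*} [NormedAddCommGroup E] (s : ℝ) (a : ℕ → E) : Prop :=
  ∃ B C : ℝ, ∀ n : ℕ, ‖a n‖ ≤ B * C ^ n * (n.factorial : ℝ) ^ s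

/-- The `m`-Borel operator `∑ aₙ tⁿ ↦ ∑ (aₙ / m(n)) tⁿ`. -/
def borel {E : Type*} [AddCommGroup E] [Module ℂ E] (m : ℕ → ℝ) (a : ℕ → E) : ℕ → E :=
  fun n => ((m n : ℂ)⁻¹) • a n

/-- `m` preserves Gevrey order: for every real `s`, every complex Banach space `E` and every series
with coefficients in `E`, the series has Gevrey order `s` iff its `m`-Borel transform has. -/
def PreservesGevreyOrder (m : ℕ → ℝ) : Prop :=
  ∀ (E : Type) [NormedAddCommGroup E] [NormedSpace ℂ E] [CompleteSpace E] (s : ℝ) (a : ℕ → E),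
    IsGevrey s a ↔ IsGevrey s (borel m a)

/-- The `m`-moment differentiation `∂_{m,t} (∑ aₙ tⁿ) = ∑ (m(n+1)/m(n)) aₙ₊₁ tⁿ`. -/
def momentDeriv {V : Type*} [AddCommGroup V] [Module ℂ V] (m : ℕ → ℝ) :
    Module.End ℂ (ℕ → V) where
  toFun a := fun n => ((m (n + 1) / m n : ℝ) : ℂ) • a (n + 1)
  map_add' a b := by funext n; simp
  map_smul' c a := by
    funext n
    simp only [Pi.smul_apply, RingHom.id_apply]
    exact smul_comm _ _ _

/-- `P(∂_{m,t}, ∂_z) u` for a polynomial `P(λ, ζ)` (the outer variable is `λ`, the inner one `ζ`)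
and a series `u = ∑ uₙ(z) tⁿ`; the result is the sequence of its coefficients. -/
def polyOp (P : ℂ[X][X]) (m : ℕ → ℝ) (u : ℕ → ℂ → ℂ) (n : ℕ) (z : ℂ) : ℂ :=
  P.sum fun i Q => Q.sum fun k c => c * iteratedDeriv k ((momentDeriv m ^ i) u n) z

/-! ### Symbols and pseudodifferential operators -/

/-- A holomorphic function `λ(ζ)` of the variable `ξ = ζ^{1/κ}` near infinity which has at most a
pole there: `toFun` is `ξ ↦ λ(ξ^κ)`, and `coeff` is its expansion `∑_{j ≥ -N} a_j ξ^{-j}`, written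
as a Laurent series in `ξ⁻¹`, convergent for all large `|ξ|`. -/
structure Symbol where
  toFun : ℂ → ℂ
  coeff : LaurentSeries ℂ
  hasSum : ∀ᶠ ξ in Bornology.cobounded ℂ,
    HasSum (fun j : ℤ => HahnSeries.coeff coeff j * ξ ^ (-j)) (toFun ξ)

/-- `λ(ζ) ∼ c ζ^q` at infinity for some `c ≠ 0`, where `q κ` is an integer. -/
def Symbol.HasPoleOrder (κ : ℕ) (s : Symbol) (q : ℚ) : Prop :=
  ∃ N : ℤ, (N : ℚ) = q * κ ∧ ∃ c : ℂ, c ≠ 0 ∧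
    Tendsto (fun ξ => s.toFun ξ / ξ ^ N) (Bornology.cobounded ℂ) (𝓝 c)

/-- Formal sums `∑_{b ≥ -N} c_b e_b`, where `e_b` stands for `z^{b/κ} / Γ(1 + b/κ)`. The terms with
`b ≥ 0` are the ordinary part, a power series in `z^{1/κ}`; the terms with `b < 0` are kept in order
that `∂_z` be invertible, so that the operators `λ(∂_z)` compose as their symbols multiply. -/
abbrev GenSeries := LaurentSeries ℂ

/-- The operator `λ(∂_z)`, which is given by `λ(∂_z) e_b = ∑_j a_j e_{b+j}` when
`λ(ζ) = ∑_j a_j ζ^{-j/κ}`. Coefficientwise this is the product of Laurent series. -/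
def Symbol.op (s : Symbol) : Module.End ℂ GenSeries where
  toFun F := s.coeff * F
  map_add' F G := mul_add _ _ _
  map_smul' c F := by
    rw [RingHom.id_apply, ← HahnSeries.C_mul_eq_smul, ← HahnSeries.C_mul_eq_smul]
    exact mul_left_comm _ _ _

/-- `λ(∂_z)` on formal power series in `t`, acting on each coefficient. -/
def Symbol.opT (s : Symbol) : Module.End ℂ (ℕ → GenSeries) := s.op.compLeft ℕ

/-- A germ `φ` of a holomorphic function at `0`, as the sum
`∑ φ⁽ⁿ⁾(0) zⁿ / n! = ∑ φ⁽ⁿ⁾(0) e_{κ n}`. -/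
def ofGerm (κ : ℕ) (φ : ℂ → ℂ) : GenSeries :=
  HahnSeries.ofPowerSeries ℤ ℂ
    (PowerSeries.mk fun b => if κ ∣ b then iteratedDeriv (b / κ) φ 0 else 0)

/-- `f` is the function of `x = z^{1/κ}` near `0` which is the sum of the ordinary part of `F`. -/
def IsRegularPart (κ : ℕ) (F : GenSeries) (f : ℂ → ℂ) : Prop :=
  ∀ᶠ x in 𝓝 (0 : ℂ),
    HasSum (fun b : ℕ => F.coeff (b : ℤ) / (Real.Gamma (1 + (b : ℝ) / κ) : ℂ) * x ^ b) (f x)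

/-- The series `w = ∑ wₙ tⁿ`, with coefficients holomorphic functions of `x = z^{1/κ}`, is a formal
solution of the pseudodifferential Cauchy problem
`T u = 0`, `∂_{m,t}^β u(0, z) = g β` for `β < N`. -/
def SolvesPseudo (κ : ℕ) (m : ℕ → ℝ) (T : Module.End ℂ (ℕ → GenSeries)) (N : ℕ)
    (g : ℕ → GenSeries) (w : ℕ → ℂ → ℂ) : Prop :=
  ∃ U : ℕ → GenSeries,
    T U = 0 ∧ (∀ β < N, (momentDeriv m ^ β) U 0 = g β) ∧ ∀ n, IsRegularPart κ (U n) (w n)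

/-! ### Factorisation and normalised solutions -/

/-- `P(λ, ζ) = P₀(ζ) ∏_j ∏_l (λ - λ_{jl}(ζ))^{p_{jl}}` near `ζ = ∞`, where the `λ_{jl}` are distinct
functions of `ζ^{1/κ}` with `λ_{jl}(ζ) ∼ c_{jl} ζ^{q_j}`, `c_{jl} ≠ 0`. -/
structure IsFactorization (P : ℂ[X][X]) (κ : ℕ) {n : ℕ} (pn : Fin n → ℕ)
    (lam : (j : Fin n) → Fin (pn j) → Symbol) (mult : (j : Fin n) → Fin (pn j) → ℕ)
    (q : Fin n → ℚ) : Prop where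
  mult_pos : ∀ j l, 0 < mult j l
  sum_mult : ∑ j, ∑ l, mult j l = P.natDegree
  distinct : Function.Injective fun i : (Σ j : Fin n, Fin (pn j)) => (lam i.1 i.2).coeff
  asymp : ∀ j l, (lam j l).HasPoleOrder κ (q j)
  eq_prod : ∀ᶠ ξ in Bornology.cobounded ℂ, ∀ x : ℂ,
    (P.map (evalRingHom (ξ ^ κ))).eval x =
      P.leadingCoeff.eval (ξ ^ κ) * ∏ j, ∏ l, (x - (lam j l).toFun ξ) ^ mult j l

/-- The operator `∏_j ∏_l (∂_{m,t} - λ_{jl}(∂_z))^{p_{jl}}`. -/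
def prodOp (m : ℕ → ℝ) {n : ℕ} (pn : Fin n → ℕ) (lam : (j : Fin n) → Fin (pn j) → Symbol)
    (mult : (j : Fin n) → Fin (pn j) → ℕ) : Module.End ℂ (ℕ → GenSeries) :=
  ((List.finRange n).map fun j =>
    ((List.finRange (pn j)).map fun l =>
      (momentDeriv m - (lam j l).opT) ^ mult j l).prod).prod

/-- `u = ∑ uₙ(z) tⁿ`, with all `uₙ` holomorphic on the disc `|z| < r`, is a formal solution of
`P(∂_{m,t}, ∂_z) u = 0`, `∂_{m,t}^j u(0, z) = φ_j(z)` for `j < p = deg_λ P`. -/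
structure IsFormalSolution (P : ℂ[X][X]) (m : ℕ → ℝ) (r : ℝ) (φ : Fin P.natDegree → ℂ → ℂ)
    (u : ℕ → ℂ → ℂ) : Prop where
  holo : ∀ n, DifferentiableOn ℂ (u n) (Metric.ball 0 r)
  eqn : ∀ n, ∀ z ∈ Metric.ball (0 : ℂ) r, polyOp P m u n z = 0
  init : ∀ j : Fin P.natDegree, ∀ z ∈ Metric.ball (0 : ℂ) r,
    (momentDeriv m ^ (j : ℕ)) u 0 z = φ j z

/-- The initial data as a sequence of formal sums. -/
def initialData (κ : ℕ) {p : ℕ} (φ : Fin p → ℂ → ℂ) (j : ℕ) : GenSeries :=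
  if h : j < p then ofGerm κ (φ ⟨j, h⟩) else 0

/-- The formal solution `u` is normalised: it also solves
`∏_j ∏_l (∂_{m,t} - λ_{jl}(∂_z))^{p_{jl}} u = 0` with the same initial data. -/
def IsNormalizedSolution (P : ℂ[X][X]) (κ : ℕ) {n : ℕ} (pn : Fin n → ℕ)
    (lam : (j : Fin n) → Fin (pn j) → Symbol) (mult : (j : Fin n) → Fin (pn j) → ℕ)
    (m : ℕ → ℝ) (r : ℝ) (φ : Fin P.natDegree → ℂ → ℂ) (u : ℕ → ℂ → ℂ) : Prop :=
  IsFormalSolution P m r φ u ∧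
    SolvesPseudo κ m (prodOp m pn lam mult) P.natDegree (initialData κ φ)
      (fun i x => u i (x ^ κ))

/-- `w = ∑ wₙ tⁿ` is Gevrey of order `s` with respect to `t`: for some `ρ > 0` all `wₙ` are
holomorphic on the disc of radius `ρ` and continuous on its closure, and in the sup norm over the
disc `‖wₙ‖ ≤ B Cⁿ (n!)^s`. -/
def IsGevreyInT (s : ℝ) (w : ℕ → ℂ → ℂ) : Prop :=
  ∃ ρ > (0 : ℝ), (∀ n, DiffContOnCl ℂ (w n) (Metric.ball 0 ρ)) ∧
    ∃ B C : ℝ, ∀ n : ℕ, ∀ x ∈ Metric.ball (0 : ℂ) ρ,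
      ‖w n x‖ ≤ B * C ^ n * (n.factorial : ℝ) ^ s

/-- `f` is an entire function of exponential growth of order at most `k`. -/
def IsEntireOfGrowth (k : ℝ) (f : ℂ → ℂ) : Prop :=
  Differentiable ℂ f ∧ ∃ A > (0 : ℝ), ∃ B > (0 : ℝ), ∀ z, ‖f z‖ < A * Real.exp (B * ‖z‖ ^ k)

end MomentPDE

end

open Filter Topology Polynomial

noncomputable section

namespace MomentPDE

/-! ### Growth bounds for coefficients of power series -/

/-! On formal sums, `λ(∂_z)` is multiplication by the Laurent series of `λ`. These series lie in the
field `K` of convergent Laurent series in `ζ^{-1/κ}`, so the factorised equation is a linear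
recurrence in `n` with constant coefficients in `K`. As for an ordinary recurrence, each root `λ`
has the elementary solutions `C(n,a)/m(n) · λⁿ F` for `a` below its multiplicity. By Pascal's rule,
`∂_{m,t} - λ` lowers `a` by one, so its power `a + 1` annihilates them; their initial values are
`C(β,a) λ^β F`, which vanish for `β < a` and equal `λ^a F` at `β = a`. Here `a` is `α - 1`. Matching
the initial data is a confluent Vandermonde system. Its nodes are distinct and nonzero, so it is
invertible over `K`, and the entries of the inverse are the symbols `d`. The recurrence determines a
solution from its first `p` coefficients, so the given solution is the sum of the elementary ones.
For the Gevrey bounds, suppose `F` has coefficients of size `(i!)^{s/κ}` up to geometric factors,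
and `λ` has a pole of order at most `N` in `ζ^{1/κ}`. Then the coefficient of `e_b` in `λⁿ F`
involves `F` only up to index `b + nN + const`. The resulting factorial splits into a power of `b!`,
absorbed by `Γ(1 + b/κ)`, and `(n!)^{Ns/κ}`. Cauchy's estimates give `s = 1` for germs and `s =
max(1 - 1/k, 0)` for entire data of growth `k`; `1/m(n)` costs only a geometric factor. -/

theorem norm_coeff_mul_le {f g : PowerSeries ℂ} {w : ℕ → ℝ} (hw : Monotone w) (hw0 : ∀ i, 0 ≤ w i)
    {A B C D : ℝ} (hA : 0 ≤ A) (hB : 0 ≤ B) (hC : 0 ≤ C) (hCD : 2 * C ≤ D)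
    (hf : ∀ i, ‖PowerSeries.coeff i f‖ ≤ A * C ^ i)
    (hg : ∀ i, ‖PowerSeries.coeff i g‖ ≤ B * D ^ i * w i) (i : ℕ) :
    ‖PowerSeries.coeff i (f * g)‖ ≤ 2 * A * B * D ^ i * w i := by
  have hD : 0 ≤ D := by linarith
  rw [PowerSeries.coeff_mul, Finset.Nat.sum_antidiagonal_eq_sum_range_succ
    (fun a b => PowerSeries.coeff a f * PowerSeries.coeff b g)]
  calc ‖∑ k ∈ Finset.range i.succ, PowerSeries.coeff k f * PowerSeries.coeff (i - k) g‖
      ≤ ∑ k ∈ Finset.range i.succ, A * B * D ^ i * w i * (1 / 2) ^ k := by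
        refine norm_sum_le_of_le _ fun k hk => ?_
        have hk' : k ≤ i := Nat.lt_succ_iff.1 (Finset.mem_range.1 hk)
        rw [norm_mul]
        calc _ ≤ (A * C ^ k) * (B * D ^ (i - k) * w (i - k)) :=
              mul_le_mul (hf k) (hg _) (norm_nonneg _) (by positivity)
          -- Monotonicity takes the weight out of the convolution, and `C ≤ D / 2` leaves a
          -- geometric series in `k`.
          _ ≤ (A * (D / 2) ^ k) * (B * D ^ (i - k) * w i) := by
              have h1 : C ≤ D / 2 := by linarith
              have h2 : w (i - k) ≤ w i := hw (Nat.sub_le _ _)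
              have := hw0 (i - k)
              gcongr
          _ = _ := by
              rw [← Nat.sub_add_cancel hk', pow_add]
              simp only [Nat.sub_add_cancel hk', div_pow]
              ring
    _ = A * B * D ^ i * w i * ∑ k ∈ Finset.range i.succ, (1 / 2 : ℝ) ^ k := by
        rw [Finset.mul_sum]
    _ ≤ A * B * D ^ i * w i * 2 := by
        have := hw0 i
        exact mul_le_mul_of_nonneg_left (sum_geometric_two_le _) (by positivity)
    _ = _ := by ring

/-- The ratio `D` must not depend on `n`: iterating the product bound changes only the constant,
which grows geometrically. -/
theorem norm_coeff_pow_mul_le {f g : PowerSeries ℂ} {w : ℕ → ℝ} (hw : Monotone w)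
    (hw0 : ∀ i, 0 ≤ w i) {A B C D : ℝ} (hA : 0 ≤ A) (hB : 0 ≤ B) (hC : 0 ≤ C) (hCD : 2 * C ≤ D)
    (hf : ∀ i, ‖PowerSeries.coeff i f‖ ≤ A * C ^ i)
    (hg : ∀ i, ‖PowerSeries.coeff i g‖ ≤ B * D ^ i * w i) (n i : ℕ) :
    ‖PowerSeries.coeff i (f ^ n * g)‖ ≤ (2 * A) ^ n * B * D ^ i * w i := by
  induction n generalizing i with
  | zero => simpa using hg i
  | succ n ih =>
    rw [pow_succ', mul_assoc]
    refine (norm_coeff_mul_le hw hw0 hA (by positivity) hC hCD hf ih i).trans_eq ?_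
    ring

/-- Induction on the recursion expressing each coefficient of the inverse through the earlier ones.
The ratio `2E` satisfies `c B C^(k+1) ≤ E^(k+1)`, so the `k`-th term gains `2^{-(k+1)}` and the sum
closes the induction. -/
theorem norm_coeff_inv_le {f : PowerSeries ℂ} (h0 : PowerSeries.constantCoeff f ≠ 0) {B C : ℝ}
    (hB : 0 ≤ B) (hC : 0 ≤ C) (hf : ∀ i, ‖PowerSeries.coeff i f‖ ≤ B * C ^ i) (n : ℕ) :
    ‖PowerSeries.coeff n f⁻¹‖ ≤ ‖(PowerSeries.constantCoeff f)⁻¹‖ *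
      (2 * (C * (1 + ‖(PowerSeries.constantCoeff f)⁻¹‖ * B))) ^ n := by
  set c := ‖(PowerSeries.constantCoeff f)⁻¹‖ with hc
  have hc0 : 0 ≤ c := norm_nonneg _
  set E := C * (1 + c * B) with hE
  have hE0 : 0 ≤ E := by positivity
  induction n using Nat.strong_induction_on with
  | _ n ih =>
  cases n with
  | zero => simp [hc, PowerSeries.constantCoeff_inv]
  | succ n =>
    have h1 : PowerSeries.coeff (n + 1) (f * f⁻¹) = 0 := by
      rw [PowerSeries.mul_inv_cancel f h0]; simp [PowerSeries.coeff_one]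
    rw [PowerSeries.coeff_mul, Finset.Nat.sum_antidiagonal_eq_sum_range_succ
      (fun a b => PowerSeries.coeff a f * PowerSeries.coeff b f⁻¹), Finset.sum_range_succ'] at h1
    simp only [PowerSeries.coeff_zero_eq_constantCoeff, Nat.sub_zero, Nat.add_sub_add_right] at h1
    have h2 : PowerSeries.coeff (n + 1) f⁻¹ = (PowerSeries.constantCoeff f)⁻¹ *
        -∑ k ∈ Finset.range (n + 1), PowerSeries.coeff (k + 1) f * PowerSeries.coeff (n - k) f⁻¹ := by
      rw [eq_inv_mul_iff_mul_eq₀ h0]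
      linear_combination h1
    rw [h2, norm_mul, norm_neg]
    refine mul_le_mul_of_nonneg_left ?_ hc0
    calc ‖∑ k ∈ Finset.range (n + 1), PowerSeries.coeff (k + 1) f * PowerSeries.coeff (n - k) f⁻¹‖
        ≤ ∑ k ∈ Finset.range (n + 1), (2 * E) ^ (n + 1) * (1 / 2) * (1 / 2) ^ k := by
          refine norm_sum_le_of_le _ fun k hk => ?_
          have hk' : k ≤ n := Nat.lt_succ_iff.1 (Finset.mem_range.1 hk)
          rw [norm_mul]
          calc _ ≤ (B * C ^ (k + 1)) * (c * (2 * E) ^ (n - k)) :=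
                mul_le_mul (hf _) (ih _ (by omega)) (norm_nonneg _) (by positivity)
            _ = (c * B) * C ^ (k + 1) * (2 * E) ^ (n - k) := by ring
            _ ≤ (1 + c * B) ^ (k + 1) * C ^ (k + 1) * (2 * E) ^ (n - k) := by
                gcongr
                have : (0 : ℝ) ≤ c * B := by positivity
                exact (by linarith : c * B ≤ 1 + c * B).trans
                  (le_self_pow₀ (by linarith) (by omega))
            _ = (2 * E) ^ (n - k) * (2 * E) ^ (k + 1) * (1 / 2) ^ (k + 1) := by
                rw [mul_pow 2 E (k + 1), hE, mul_pow C, one_div, inv_pow]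
                field_simp
            _ = _ := by
                rw [← pow_add, show n - k + (k + 1) = n + 1 by omega, pow_succ (1 / 2 : ℝ)]
                ring
      _ = (2 * E) ^ (n + 1) * (1 / 2) * ∑ k ∈ Finset.range (n + 1), (1 / 2 : ℝ) ^ k := by
          rw [Finset.mul_sum]
      _ ≤ (2 * E) ^ (n + 1) * (1 / 2) * 2 :=
          mul_le_mul_of_nonneg_left (sum_geometric_two_le _) (by positivity)
      _ = _ := by ring

/-- `‖fᵢ‖ ≤ B Cⁱ (i!)^σ`, with normalised constants. -/
def HasFactorialBound (σ : ℝ) (f : PowerSeries ℂ) : Prop :=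
  ∃ B C : ℝ, 0 ≤ B ∧ 1 ≤ C ∧
    ∀ i : ℕ, ‖PowerSeries.coeff i f‖ ≤ B * C ^ i * (i.factorial : ℝ) ^ σ

theorem factorial_rpow_monotone {σ : ℝ} (hσ : 0 ≤ σ) :
    Monotone fun i : ℕ => (i.factorial : ℝ) ^ σ := fun _ _ h =>
  Real.rpow_le_rpow (by positivity) (by exact_mod_cast Nat.factorial_le h) hσ

/-- The asymmetric form, with one factor convergent, makes the series of type `σ` a module over the
convergent ones: symbols act on initial data. -/
theorem HasFactorialBound.mul {σ : ℝ} (hσ : 0 ≤ σ) {f g : PowerSeries ℂ}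
    (hf : HasFactorialBound 0 f) (hg : HasFactorialBound σ g) : HasFactorialBound σ (f * g) := by
  obtain ⟨A, C, hA, hC, hf⟩ := hf
  obtain ⟨B, D, hB, hD, hg⟩ := hg
  refine ⟨2 * A * B, 2 * C + D, by positivity, by linarith, ?_⟩
  refine norm_coeff_mul_le (C := C) (factorial_rpow_monotone hσ) (fun i => by positivity) hA hB
    (by linarith) (by linarith) (fun i => by simpa using hf i) fun i => (hg i).trans ?_
  gcongr
  linarith

theorem HasFactorialBound.add {σ : ℝ} {f g : PowerSeries ℂ}
    (hf : HasFactorialBound σ f) (hg : HasFactorialBound σ g) : HasFactorialBound σ (f + g) := by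
  obtain ⟨A, C, hA, hC, hf⟩ := hf
  obtain ⟨B, D, hB, hD, hg⟩ := hg
  refine ⟨A + B, max C D, by positivity, hC.trans (le_max_left _ _), fun i => ?_⟩
  rw [map_add]
  calc _ ≤ A * (max C D) ^ i * (i.factorial : ℝ) ^ σ + B * (max C D) ^ i * (i.factorial : ℝ) ^ σ := by
        refine (norm_add_le _ _).trans (add_le_add ((hf i).trans ?_) ((hg i).trans ?_))
        · gcongr
          exact le_max_left _ _
        · gcongr
          exact le_max_right _ _
    _ = _ := by ring

theorem HasFactorialBound.neg {σ : ℝ} {f : PowerSeries ℂ}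
    (hf : HasFactorialBound σ f) : HasFactorialBound σ (-f) := by
  obtain ⟨B, C, hB, hC, hf⟩ := hf
  exact ⟨B, C, hB, hC, fun i => by simpa using hf i⟩

theorem hasFactorialBound_X_pow (n : ℕ) : HasFactorialBound 0 (PowerSeries.X ^ n) := by
  refine ⟨1, 1, zero_le_one, le_rfl, fun i => ?_⟩
  rw [PowerSeries.coeff_X_pow]
  split_ifs <;> simp

/-- Removing the power of `X` leaves a unit; the index shift costs only `C ^ order` in the constant.
-/
theorem HasFactorialBound.inv_divXPowOrder {f : PowerSeries ℂ} (h0 : f ≠ 0)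
    (hf : HasFactorialBound 0 f) : HasFactorialBound 0 f.divXPowOrder⁻¹ := by
  obtain ⟨B, C, hB, hC, hf⟩ := hf
  have hc : PowerSeries.constantCoeff f.divXPowOrder ≠ 0 := fun h =>
    h0 (PowerSeries.constantCoeff_divXPowOrder_eq_zero_iff.1 h)
  have key := norm_coeff_inv_le (f := f.divXPowOrder) (B := B * C ^ f.order.toNat) (C := C) hc
    (by positivity) (by positivity) fun i => by
      rw [PowerSeries.coeff_divXPowOrder]
      refine (hf _).trans_eq ?_
      rw [Real.rpow_zero, pow_add]; ring
  refine ⟨_, _, norm_nonneg _, ?_, fun i => (key i).trans_eq (by rw [Real.rpow_zero, mul_one])⟩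
  have : (0 : ℝ) ≤ ‖(PowerSeries.constantCoeff f.divXPowOrder)⁻¹‖ * (B * C ^ f.order.toNat) := by
    positivity
  nlinarith

/-! ### Laurent series with such bounds -/

/-- A Laurent series whose coefficients are bounded by `B Cⁱ (i!)^σ`. -/
def IsTame (σ : ℝ) (F : LaurentSeries ℂ) : Prop :=
  ∃ (k : ℤ) (f : PowerSeries ℂ), HasFactorialBound σ f ∧
    F = HahnSeries.single k 1 * HahnSeries.ofPowerSeries ℤ ℂ f

theorem IsTame.mul {σ : ℝ} (hσ : 0 ≤ σ) {F G : LaurentSeries ℂ} (hF : IsTame 0 F)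
    (hG : IsTame σ G) : IsTame σ (F * G) := by
  obtain ⟨k, f, hf, rfl⟩ := hF
  obtain ⟨l, g, hg, rfl⟩ := hG
  refine ⟨k + l, f * g, hf.mul hσ hg, ?_⟩
  rw [map_mul, ← one_mul (1 : ℂ), ← HahnSeries.single_mul_single, one_mul]
  ring

/-- Brings two tame series to a common leading exponent, so that they can be added. -/
theorem IsTame.exists_of_le {σ : ℝ} (hσ : 0 ≤ σ) {k l : ℤ} (hkl : l ≤ k) {f : PowerSeries ℂ}
    (hf : HasFactorialBound σ f) :
    ∃ g : PowerSeries ℂ, HasFactorialBound σ g ∧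
      (HahnSeries.single k 1 * HahnSeries.ofPowerSeries ℤ ℂ f : LaurentSeries ℂ) =
        HahnSeries.single l 1 * HahnSeries.ofPowerSeries ℤ ℂ g := by
  refine ⟨PowerSeries.X ^ (k - l).toNat * f, (hasFactorialBound_X_pow _).mul hσ hf, ?_⟩
  rw [map_mul, HahnSeries.ofPowerSeries_X_pow, ← mul_assoc, HahnSeries.single_mul_single,
    show l + (((k - l).toNat : ℕ) : ℤ) = k by omega, one_mul]

theorem IsTame.add {σ : ℝ} (hσ : 0 ≤ σ) {F G : LaurentSeries ℂ} (hF : IsTame σ F)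
    (hG : IsTame σ G) : IsTame σ (F + G) := by
  obtain ⟨k, f, hf, rfl⟩ := hF
  obtain ⟨l, g, hg, rfl⟩ := hG
  obtain ⟨f', hf', h1⟩ := IsTame.exists_of_le hσ (min_le_left k l) hf
  obtain ⟨g', hg', h2⟩ := IsTame.exists_of_le hσ (min_le_right k l) hg
  exact ⟨min k l, f' + g', hf'.add hg', by rw [h1, h2, map_add, mul_add]⟩

theorem isTame_zero (σ : ℝ) : IsTame σ 0 :=
  ⟨0, 0, ⟨0, 1, le_rfl, le_rfl, fun i => by simp⟩, by simp⟩

theorem IsTame.sum {σ : ℝ} (hσ : 0 ≤ σ) {ι : Type*} (s : Finset ι) {F : ι → LaurentSeries ℂ}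
    (hF : ∀ i ∈ s, IsTame σ (F i)) : IsTame σ (∑ i ∈ s, F i) :=
  Finset.sum_induction _ _ (fun _ _ => IsTame.add hσ) (isTame_zero σ) hF

theorem isTame_one : IsTame 0 1 :=
  ⟨0, 1, by simpa using hasFactorialBound_X_pow 0, by simp⟩

theorem IsTame.inv {F : LaurentSeries ℂ} (hF : IsTame 0 F) : IsTame 0 F⁻¹ := by
  by_cases h0 : F = 0
  · simpa [h0] using isTame_zero 0
  obtain ⟨k, f, hf, rfl⟩ := hF
  have hf0 : f ≠ 0 := by rintro rfl; simp at h0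
  have hc : PowerSeries.constantCoeff f.divXPowOrder ≠ 0 := fun h =>
    hf0 (PowerSeries.constantCoeff_divXPowOrder_eq_zero_iff.1 h)
  refine ⟨-(k + f.order.toNat), _, hf.inv_divXPowOrder hf0, ?_⟩
  rw [inv_eq_iff_eq_inv, eq_comm]
  refine inv_eq_of_mul_eq_one_right ?_
  have hsplit : HahnSeries.ofPowerSeries ℤ ℂ f = HahnSeries.single (f.order.toNat : ℤ) 1 *
      HahnSeries.ofPowerSeries ℤ ℂ f.divXPowOrder := by
    conv_lhs => rw [← PowerSeries.X_pow_order_mul_divXPowOrder (f := f)]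
    rw [map_mul, HahnSeries.ofPowerSeries_X_pow]
  rw [hsplit]
  calc _ = (HahnSeries.single (-(k + (f.order.toNat : ℤ))) (1 : ℂ) *
          (HahnSeries.single k 1 * HahnSeries.single (f.order.toNat : ℤ) 1)) *
        (HahnSeries.ofPowerSeries ℤ ℂ f.divXPowOrder *
          HahnSeries.ofPowerSeries ℤ ℂ f.divXPowOrder⁻¹) := by
        ring
    _ = 1 := by
        rw [HahnSeries.single_mul_single, HahnSeries.single_mul_single, ← map_mul,
          PowerSeries.mul_inv_cancel _ hc]
        simp

/-- The field of convergent Laurent series. -/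
def convergentSubfield : Subfield (LaurentSeries ℂ) where
  carrier := {F | IsTame 0 F}
  mul_mem' := IsTame.mul le_rfl
  one_mem' := isTame_one
  add_mem' := IsTame.add le_rfl
  zero_mem' := isTame_zero 0
  neg_mem' := by
    rintro _ ⟨k, f, hf, rfl⟩
    exact ⟨k, -f, hf.neg, by
      rw [map_neg]
      exact (mul_neg (HahnSeries.single k (1 : ℂ)) (HahnSeries.ofPowerSeries ℤ ℂ f)).symm⟩
  inv_mem' _ := IsTame.inv

/-! ### Symbols and convergent Laurent series -/

theorem coeff_single_mul_ofPowerSeries (k b : ℤ) (f : PowerSeries ℂ) :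
    (HahnSeries.single k 1 * HahnSeries.ofPowerSeries ℤ ℂ f : LaurentSeries ℂ).coeff b =
      if b < k then 0 else PowerSeries.coeff (b - k).toNat f := by
  rw [HahnSeries.coeff_single_mul, one_mul, PowerSeries.coeff_coe]
  by_cases h : b < k
  · rw [if_pos h, if_pos (by omega)]
  · rw [if_neg h, if_neg (by omega), show (b - k).natAbs = (b - k).toNat by omega]

/-- The terms of a series converging at a single `ξ` are bounded there; `‖ξ‖` serves as the ratio.
-/
theorem Symbol.exists_norm_coeff_le (s : Symbol) :
    ∃ B C : ℝ, 0 ≤ B ∧ 1 ≤ C ∧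
      ∀ i, ‖PowerSeries.coeff i s.coeff.powerSeriesPart‖ ≤ B * C ^ i := by
  obtain ⟨ξ, hξ, hs⟩ := ((eventually_cobounded_le_norm (1 : ℝ)).and s.hasSum).exists
  have hξ0 : 0 < ‖ξ‖ := by linarith
  obtain ⟨B, hB⟩ := hs.summable.norm.tendsto_cofinite_zero.bddAbove_range_of_cofinite
  have hB' : ∀ j : ℤ, ‖s.coeff.coeff j * ξ ^ (-j)‖ ≤ B := fun j => hB ⟨j, rfl⟩
  have hB0 : 0 ≤ B := (norm_nonneg _).trans (hB' 0)
  refine ⟨B * ‖ξ‖ ^ s.coeff.order, ‖ξ‖, by positivity, hξ, fun i => ?_⟩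
  have h := hB' (s.coeff.order + i)
  rw [norm_mul, zpow_neg, norm_inv, norm_zpow, ← div_eq_mul_inv, div_le_iff₀ (by positivity),
    zpow_add₀ hξ0.ne', zpow_natCast, ← mul_assoc] at h
  rwa [LaurentSeries.powerSeriesPart_coeff]

theorem Symbol.isTame_coeff (s : Symbol) : IsTame 0 s.coeff := by
  obtain ⟨B, C, hB, hC, h⟩ := s.exists_norm_coeff_le
  exact ⟨s.coeff.order, s.coeff.powerSeriesPart, ⟨B, C, hB, hC, fun i => by simpa using h i⟩,
    (LaurentSeries.single_order_mul_powerSeriesPart _).symm⟩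

theorem IsTame.exists_symbol {F : LaurentSeries ℂ} (hF : IsTame 0 F) :
    ∃ s : Symbol, s.coeff = F := by
  -- Where the series is not summable the `tsum` takes its default value, which is harmless: a
  -- symbol is constrained only near infinity.
  refine ⟨⟨fun ξ => ∑' j : ℤ, F.coeff j * ξ ^ (-j), F, ?_⟩, rfl⟩
  obtain ⟨k, f, ⟨B, C, hB, hC, hf⟩, rfl⟩ := hF
  filter_upwards [eventually_cobounded_le_norm (2 * C)] with ξ hξ
  refine Summable.hasSum ?_
  have hinj : Function.Injective fun i : ℕ => k + (i : ℤ) := fun a b h => by simpa using h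
  have hξ0 : ξ ≠ 0 := norm_pos_iff.1 (by linarith)
  rw [← hinj.summable_iff]
  · refine Summable.of_norm_bounded (g := fun i : ℕ => ‖ξ ^ (-k)‖ * B * (1 / 2) ^ i)
      (summable_geometric_two.mul_left _) fun i => ?_
    simp only [Function.comp, coeff_single_mul_ofPowerSeries]
    rw [if_neg (by omega), show (k + (i : ℤ) - k).toNat = i by omega, neg_add, zpow_add₀ hξ0,
      norm_mul, norm_mul]
    have h1 : ‖ξ ^ (-(i : ℤ))‖ ≤ (2 * C)⁻¹ ^ i := by
      rw [zpow_neg, zpow_natCast, norm_inv, norm_pow, inv_pow]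
      gcongr
    calc _ ≤ B * C ^ i * (‖ξ ^ (-k)‖ * (2 * C)⁻¹ ^ i) := by
          gcongr
          simpa using hf i
      _ = _ := by
          have : C ≠ 0 := by positivity
          rw [mul_inv, mul_pow, inv_pow C]
          field_simp
  · intro j hj
    rw [coeff_single_mul_ofPowerSeries, if_pos, zero_mul]
    by_contra h
    exact hj ⟨(j - k).toNat, by simp; omega⟩

/-! ### The confluent Vandermonde system -/

/-- The factor `x ^ a` turns the entries `C(β,a) x^{β-a}` of the usual confluent Vandermonde matrix
into the initial values `C(β,a) x^β` of elementary solutions. -/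
theorem eval_hasseDeriv_mul_pow {F : Type*} [Field F] (Q : F[X]) {p : ℕ} (hQ : Q.degree < p)
    (x : F) (a : ℕ) :
    (hasseDeriv a Q).eval x * x ^ a =
      ∑ β : Fin p, Q.coeff β * (((β : ℕ).choose a : F) * x ^ (β : ℕ)) := by
  have hsupp : Q.support ⊆ Finset.range p := fun i hi => by
    rw [Finset.mem_range]
    by_contra h
    exact mem_support_iff.1 hi (coeff_eq_zero_of_degree_lt
      (hQ.trans_le (by exact_mod_cast not_lt.1 h)))
  rw [hasseDeriv_apply, Polynomial.sum_eq_of_subset _ (by simp) hsupp, eval_finsetSum, Finset.sum_mul, Finset.sum_range]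
  refine Finset.sum_congr rfl fun β _ => ?_
  rw [eval_monomial]
  by_cases h : a ≤ (β : ℕ)
  · rw [mul_assoc, ← pow_add, Nat.sub_add_cancel h]; ring
  · simp [Nat.choose_eq_zero_of_lt (not_le.1 h)]

/-- A vector in the left kernel is the coefficient vector of a polynomial of degree below `p` which
vanishes at each node to the order of its multiplicity. It is divisible by a product of degree `p`,
hence zero. The nodes must be nonzero in order to cancel the factor `x ^ a`. -/
theorem exists_confluentVandermonde_inverse {F : Type*} [Field F] {I : Type*} [Fintype I]
    (lam : I → F) (hinj : Function.Injective lam) (h0 : ∀ i, lam i ≠ 0) (mult : I → ℕ) (p : ℕ)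
    (hp : ∑ i, mult i = p) :
    ∃ d : (Σ i, Fin (mult i)) → Fin p → F, ∀ β γ : Fin p,
      ∑ x : Σ i, Fin (mult i), ((β : ℕ).choose x.2 : F) * lam x.1 ^ (β : ℕ) * d x γ =
        if β = γ then 1 else 0 := by
  classical
  have hcard : Fintype.card (Σ i, Fin (mult i)) = Fintype.card (Fin p) := by simp [hp]
  let e : (Σ i, Fin (mult i)) ≃ Fin p := Fintype.equivOfCardEq hcard
  let entry : Fin p → (Σ i, Fin (mult i)) → F := fun β x =>
    ((β : ℕ).choose x.2 : F) * lam x.1 ^ (β : ℕ)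
  let M : Matrix (Fin p) (Fin p) F := fun β y => entry β (e.symm y)
  have hMe : ∀ β x, M β (e x) = entry β x := fun β x => by simp only [M, Equiv.symm_apply_apply]
  have hM : IsUnit M := by
    rw [← Matrix.vecMul_injective_iff_isUnit]
    refine (injective_iff_map_eq_zero (Matrix.vecMulLinear M)).2 fun c hc => ?_
    have hc' : ∀ i (a : Fin (mult i)),
        ∑ β : Fin p, c β * (((β : ℕ).choose a : F) * lam i ^ (β : ℕ)) = 0 := by
      intro i a
      have := congrFun hc (e ⟨i, a⟩)
      rw [Matrix.vecMulLinear_apply] at this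
      simp only [Matrix.vecMul, dotProduct, hMe] at this
      exact this
    let Q : F[X] := ∑ β : Fin p, C (c β) * X ^ (β : ℕ)
    have hQdeg : Q.degree < p := degree_sum_fin_lt c
    have hQc : ∀ β : Fin p, Q.coeff β = c β := fun β => by
      simp only [Q, finsetSum_coeff, coeff_C_mul_X_pow, Fin.val_inj]
      simp
    have hdvd : ∏ i, (X - C (lam i)) ^ mult i ∣ Q := by
      refine Finset.prod_dvd_of_coprime
        (fun i _ j _ hij => (pairwise_coprime_X_sub_C hinj hij).pow) fun i _ => ?_
      rw [X_sub_C_pow_dvd_iff, ← taylor_apply, X_pow_dvd_iff]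
      intro a ha
      rw [taylor_coeff]
      have h := eval_hasseDeriv_mul_pow Q hQdeg (lam i) a
      simp only [hQc] at h
      rw [hc' i ⟨a, ha⟩] at h
      exact (mul_eq_zero.1 h).resolve_right (pow_ne_zero _ (h0 i))
    have hQ0 : Q = 0 := by
      by_contra hne
      have h1 := degree_le_of_dvd hdvd hne
      rw [degree_prod] at h1
      simp only [degree_pow, degree_X_sub_C, nsmul_eq_mul, mul_one] at h1
      rw [← Nat.cast_sum, hp] at h1
      exact absurd hQdeg (not_lt.2 h1)
    funext β
    rw [← hQc β, hQ0]; simp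
  obtain ⟨N, hN⟩ := hM.exists_right_inv
  refine ⟨fun x γ => N (e x) γ, fun β γ => ?_⟩
  have := congrFun (congrFun hN β) γ
  rw [Matrix.mul_apply, Matrix.one_apply] at this
  rw [← this, ← Equiv.sum_comp e]
  simp only [hMe, entry]

/-! ### Recurrences for formal solutions -/

theorem momentDeriv_apply {V : Type*} [AddCommGroup V] [Module ℂ V] (m : ℕ → ℝ) (a : ℕ → V)
    (n : ℕ) : momentDeriv m a n = ((m (n + 1) / m n : ℝ) : ℂ) • a (n + 1) := rfl

theorem momentDeriv_pow_apply {V : Type*} [AddCommGroup V] [Module ℂ V] {m : ℕ → ℝ}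
    (hm : ∀ i, 0 < m i) (a : ℕ → V) (β n : ℕ) :
    (momentDeriv m ^ β) a n = ((m (n + β) / m n : ℝ) : ℂ) • a (n + β) := by
  induction β generalizing n with
  | zero => simp [div_self (hm n).ne']
  | succ β ih =>
    rw [pow_succ', Module.End.mul_apply, momentDeriv_apply, ih, smul_smul, ← Complex.ofReal_mul,
      show n + 1 + β = n + (β + 1) by ring]
    congr 2
    have := (hm (n + 1)).ne'
    have := (hm n).ne'
    field_simp

theorem Symbol.op_apply (s : Symbol) (F : GenSeries) : s.op F = s.coeff * F := rfl

theorem Symbol.opT_apply (s : Symbol) (U : ℕ → GenSeries) (n : ℕ) :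
    s.opT U n = s.coeff * U n := rfl

theorem Symbol.op_pow_apply (s : Symbol) (n : ℕ) (F : GenSeries) :
    (s.op ^ n) F = s.coeff ^ n * F := by
  induction n with
  | zero => simp
  | succ n ih => rw [pow_succ', Module.End.mul_apply, ih, Symbol.op_apply, pow_succ', mul_assoc]

theorem mul_smul_genSeries (c : ℂ) (F G : GenSeries) : F * c • G = c • (F * G) := by
  rw [← HahnSeries.C_mul_eq_smul, ← HahnSeries.C_mul_eq_smul]
  exact mul_left_comm _ _ _

/-- The operator `∂_{m,t} - λ(∂_z)`. -/
abbrev factorOp (m : ℕ → ℝ) (s : Symbol) : Module.End ℂ (ℕ → GenSeries) :=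
  momentDeriv m - s.opT

theorem commute_factorOp (m : ℕ → ℝ) (s t : Symbol) :
    Commute (factorOp m s) (factorOp m t) := by
  refine LinearMap.ext fun U => funext fun n => ?_
  simp only [Module.End.mul_apply, LinearMap.sub_apply, Pi.sub_apply, momentDeriv_apply,
    Symbol.opT_apply, smul_sub, mul_sub, mul_smul_genSeries]
  rw [mul_left_comm s.coeff t.coeff]
  abel

theorem list_prod_apply_eq_zero {V : Type*} [AddCommGroup V] [Module ℂ V]
    {L : List (Module.End ℂ V)} {T : Module.End ℂ V} (hT : T ∈ L) (hcomm : ∀ S ∈ L, Commute T S)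
    {x : V} (hx : T x = 0) : L.prod x = 0 := by
  induction L with
  | nil => simp at hT
  | cons S L ih =>
    rw [List.prod_cons, Module.End.mul_apply]
    rcases List.mem_cons.1 hT with rfl | h
    · have : Commute T L.prod := Commute.list_prod_right _ _ fun S hS =>
        hcomm S (List.mem_cons_of_mem _ hS)
      rw [← Module.End.mul_apply, this.eq, Module.End.mul_apply, hx, map_zero]
    · rw [ih h fun S hS => hcomm S (List.mem_cons_of_mem _ hS), map_zero]

theorem prodOp_apply_eq_zero (m : ℕ → ℝ) {n : ℕ} (pn : Fin n → ℕ)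
    (lam : (j : Fin n) → Fin (pn j) → Symbol) (mult : (j : Fin n) → Fin (pn j) → ℕ)
    (j : Fin n) (l : Fin (pn j)) {U : ℕ → GenSeries}
    (hU : (factorOp m (lam j l) ^ mult j l) U = 0) :
    prodOp m pn lam mult U = 0 := by
  have hc : ∀ j l j' l', Commute (factorOp m (lam j l) ^ mult j l)
      (factorOp m (lam j' l') ^ mult j' l') := fun j l j' l' =>
    (commute_factorOp m _ _).pow_pow _ _
  refine list_prod_apply_eq_zero (List.mem_map.2 ⟨j, List.mem_finRange j, rfl⟩) ?_ ?_
  · simp only [List.mem_map, List.mem_finRange, true_and, forall_exists_index,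
      forall_apply_eq_imp_iff]
    refine fun j' => Commute.list_prod_right _ _ ?_
    simp only [List.mem_map, List.mem_finRange, true_and, forall_exists_index,
      forall_apply_eq_imp_iff]
    refine fun l' => Commute.list_prod_left _ _ ?_
    simp only [List.mem_map, List.mem_finRange, true_and, forall_exists_index,
      forall_apply_eq_imp_iff]
    exact fun l'' => hc _ _ _ _
  · refine list_prod_apply_eq_zero (List.mem_map.2 ⟨l, List.mem_finRange l, rfl⟩) ?_ hU
    simp only [List.mem_map, List.mem_finRange, true_and, forall_exists_index,
      forall_apply_eq_imp_iff]
    exact fun l' => hc _ _ _ _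

/-- `T` acts like a recurrence of order `p`: it lowers the order of vanishing at `t = 0` by at most
`p`, and its solutions are determined by their first `p` coefficients. -/
def IsRecurrence {V : Type*} [AddCommGroup V] [Module ℂ V] (T : Module.End ℂ (ℕ → V)) (p : ℕ) :
    Prop :=
  (∀ (U : ℕ → V) (k : ℕ), (∀ i < k + p, U i = 0) → ∀ i < k, T U i = 0) ∧
    ∀ U : ℕ → V, (∀ i < p, U i = 0) → T U = 0 → U = 0

section IsRecurrence

variable {V : Type*} [AddCommGroup V] [Module ℂ V]

theorem isRecurrence_one : IsRecurrence (1 : Module.End ℂ (ℕ → V)) 0 :=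
  ⟨fun _ _ h => h, fun _ _ h => h⟩

/-- The first half of the definition exists for this step: it passes vanishing initial coefficients
from `U` to `T U`, where uniqueness for `S` applies. -/
theorem IsRecurrence.mul {S T : Module.End ℂ (ℕ → V)} {p r : ℕ} (hS : IsRecurrence S p)
    (hT : IsRecurrence T r) : IsRecurrence (S * T) (p + r) :=
  ⟨fun U k h => hS.1 _ k (hT.1 U (k + p) (by rwa [add_assoc])), fun U h h0 =>
    hT.2 U (fun i hi => h i (by omega)) (hS.2 _ (hT.1 U p h) h0)⟩

theorem IsRecurrence.pow {T : Module.End ℂ (ℕ → V)} {p : ℕ} (hT : IsRecurrence T p) (n : ℕ) :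
    IsRecurrence (T ^ n) (n * p) := by
  induction n with
  | zero => simpa using isRecurrence_one
  | succ n ih => rw [pow_succ, Nat.succ_mul]; exact ih.mul hT

theorem IsRecurrence.list_prod {ι : Type*} (L : List ι) {T : ι → Module.End ℂ (ℕ → V)} {p : ι → ℕ}
    (h : ∀ i, IsRecurrence (T i) (p i)) : IsRecurrence (L.map T).prod (L.map p).sum := by
  induction L with
  | nil => simpa using isRecurrence_one
  | cons i L ih => simpa using (h i).mul ih

end IsRecurrence

theorem isRecurrence_factorOp {m : ℕ → ℝ} (hm : ∀ i, 0 < m i) (s : Symbol) :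
    IsRecurrence (factorOp m s) 1 := by
  refine ⟨fun U k h i hi => ?_, fun U h h0 => ?_⟩
  · rw [LinearMap.sub_apply, Pi.sub_apply, momentDeriv_apply, Symbol.opT_apply,
      h i (by omega), h (i + 1) (by omega), smul_zero, mul_zero, sub_zero]
  · funext i
    induction i with
    | zero => exact h 0 one_pos
    | succ i ih =>
      have h1 := congrFun h0 i
      rw [LinearMap.sub_apply, Pi.sub_apply, momentDeriv_apply, Symbol.opT_apply, ih,
        Pi.zero_apply, mul_zero, sub_zero] at h1
      refine (smul_eq_zero.1 h1).resolve_left ?_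
      exact_mod_cast (div_pos (hm _) (hm _)).ne'

theorem isRecurrence_prodOp {m : ℕ → ℝ} (hm : ∀ i, 0 < m i) {n : ℕ} (pn : Fin n → ℕ)
    (lam : (j : Fin n) → Fin (pn j) → Symbol) (mult : (j : Fin n) → Fin (pn j) → ℕ) :
    IsRecurrence (prodOp m pn lam mult) (∑ j, ∑ l, mult j l) := by
  have h := IsRecurrence.list_prod (List.finRange n) fun j =>
    IsRecurrence.list_prod (p := mult j) (List.finRange (pn j)) fun l => by
      simpa using (isRecurrence_factorOp hm (lam j l)).pow (mult j l)
  simp only [Fin.sum_univ_def]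
  exact h

/-! ### Elementary solutions -/

/-- The series `∑ (C(n, a) / m(n)) λ(∂_z)ⁿ F tⁿ`. -/
def elementarySolution (m : ℕ → ℝ) (s : Symbol) (a : ℕ) (F : GenSeries) (n : ℕ) : GenSeries :=
  ((n.choose a / m n : ℝ) : ℂ) • (s.coeff ^ n * F)

/-- Pascal's rule: `C(n+1,a+1) - C(n,a+1) = C(n,a)`. The moments cancel and the surplus factor `λ`
moves onto `F`. -/
theorem factorOp_elementarySolution {m : ℕ → ℝ} (hm : ∀ i, 0 < m i) (s : Symbol) (a : ℕ)
    (F : GenSeries) : factorOp m s (elementarySolution m s (a + 1) F) =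
      elementarySolution m s a (s.coeff * F) := by
  funext n
  rw [LinearMap.sub_apply, Pi.sub_apply, momentDeriv_apply, Symbol.opT_apply]
  simp only [elementarySolution, mul_smul_genSeries, smul_smul]
  rw [pow_succ, mul_assoc, mul_left_comm (s.coeff) (s.coeff ^ n), ← sub_smul]
  congr 1
  have h1 := (hm (n + 1)).ne'
  have h2 := (hm n).ne'
  rw [← Complex.ofReal_mul, ← Complex.ofReal_sub, Nat.choose_succ_succ]
  congr 1
  push_cast
  field_simp
  ring

theorem factorOp_pow_succ_elementarySolution {m : ℕ → ℝ} (hm : ∀ i, 0 < m i) (s : Symbol) (a : ℕ)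
    (F : GenSeries) :
    (factorOp m s ^ (a + 1)) (elementarySolution m s a F) = 0 := by
  induction a generalizing F with
  | zero =>
    funext n
    rw [zero_add, pow_one, LinearMap.sub_apply, Pi.sub_apply, momentDeriv_apply, Symbol.opT_apply]
    simp only [elementarySolution, mul_smul_genSeries, smul_smul]
    rw [pow_succ, mul_assoc, mul_left_comm (s.coeff) (s.coeff ^ n), ← sub_smul]
    have h1 := (hm (n + 1)).ne'
    have h2 := (hm n).ne'
    rw [← Complex.ofReal_mul, ← Complex.ofReal_sub]
    simp only [Nat.choose_zero_right, Nat.cast_one, Pi.zero_apply]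
    rw [show m (n + 1) / m n * (1 / m (n + 1)) - 1 / m n = 0 by field_simp; ring]
    simp
  | succ a ih =>
    rw [pow_succ, Module.End.mul_apply, factorOp_elementarySolution hm, ih]

theorem momentDeriv_pow_elementarySolution_zero {m : ℕ → ℝ} (hm0 : m 0 = 1) (hm : ∀ i, 0 < m i)
    (s : Symbol) (a β : ℕ) (F : GenSeries) :
    (momentDeriv m ^ β) (elementarySolution m s a F) 0 = (β.choose a : ℂ) • (s.coeff ^ β * F) := by
  rw [momentDeriv_pow_apply hm, elementarySolution, smul_smul, zero_add, hm0, ← Complex.ofReal_mul]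
  congr 1
  have := (hm β).ne'
  rw [div_one, mul_div_cancel₀ _ this]
  simp

theorem factorOp_pow_elementarySolution {m : ℕ → ℝ} (hm : ∀ i, 0 < m i) (s : Symbol)
    {a p : ℕ} (ha : a < p) (F : GenSeries) :
    (factorOp m s ^ p) (elementarySolution m s a F) = 0 := by
  rw [show p = (p - (a + 1)) + (a + 1) by omega, pow_add, Module.End.mul_apply,
    factorOp_pow_succ_elementarySolution hm, map_zero]

/-- A solution of the factorised problem is the sum of elementary solutions, once these have the
right initial data. -/
theorem eq_sum_elementarySolution {m : ℕ → ℝ} (hm0 : m 0 = 1) (hm : ∀ i, 0 < m i) {n : ℕ}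
    (pn : Fin n → ℕ) (lam : (j : Fin n) → Fin (pn j) → Symbol)
    (mult : (j : Fin n) → Fin (pn j) → ℕ) {g : ℕ → GenSeries}
    {F : (j : Fin n) → (l : Fin (pn j)) → Fin (mult j l) → GenSeries}
    (hF : ∀ β < ∑ j, ∑ l, mult j l, ∑ j, ∑ l, ∑ a : Fin (mult j l),
      (β.choose a : ℂ) • ((lam j l).coeff ^ β * F j l a) = g β)
    {U : ℕ → GenSeries} (hU : prodOp m pn lam mult U = 0)
    (hg : ∀ β < ∑ j, ∑ l, mult j l, (momentDeriv m ^ β) U 0 = g β) :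
    U = ∑ j, ∑ l, ∑ a : Fin (mult j l), elementarySolution m (lam j l) a (F j l a) := by
  rw [← sub_eq_zero]
  refine (isRecurrence_prodOp hm pn lam mult).2 _ (fun β hβ => ?_) ?_
  · have h : (momentDeriv m ^ β) (U - ∑ j, ∑ l, ∑ a : Fin (mult j l),
        elementarySolution m (lam j l) a (F j l a)) 0 = 0 := by
      rw [map_sub, Pi.sub_apply, hg β hβ, ← hF β hβ]
      simp only [map_sum, Finset.sum_apply, momentDeriv_pow_elementarySolution_zero hm0 hm, sub_self]
    rw [momentDeriv_pow_apply hm, zero_add] at h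
    refine (smul_eq_zero.1 h).resolve_left ?_
    exact_mod_cast (div_pos (hm _) (hm _)).ne'
  · simp only [map_sub, hU, map_sum, zero_sub, neg_eq_zero]
    exact Finset.sum_eq_zero fun j _ => Finset.sum_eq_zero fun l _ => Finset.sum_eq_zero fun a _ =>
      prodOp_apply_eq_zero m pn lam mult j l (factorOp_pow_elementarySolution hm _ a.2 _)

/-! ### The order of a symbol -/

/-- After normalisation this is a power series in `ξ⁻¹`, dominated by a geometric series for `‖ξ‖ ≥
2C`; only its constant term survives in the limit. -/
theorem Symbol.tendsto_mul_zpow_order (s : Symbol) :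
    Tendsto (fun ξ => s.toFun ξ * ξ ^ s.coeff.order) (Bornology.cobounded ℂ)
      (𝓝 (s.coeff.coeff s.coeff.order)) := by
  obtain ⟨B, C, hB, hC, hf⟩ := s.exists_norm_coeff_le
  set o := s.coeff.order
  set f := s.coeff.powerSeriesPart with hfdef
  have hinj : Function.Injective fun i : ℕ => o + (i : ℤ) := fun a b h => by simpa using h
  have hev : ∀ᶠ ξ in Bornology.cobounded ℂ,
      ∑' i : ℕ, PowerSeries.coeff i f * (ξ⁻¹) ^ i = s.toFun ξ * ξ ^ o := by
    filter_upwards [s.hasSum, eventually_cobounded_le_norm (1 : ℝ)] with ξ hs hξ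
    have hξ0 : ξ ≠ 0 := norm_pos_iff.1 (by linarith)
    have h1 := (hinj.hasSum_iff (fun j hj => by
      rw [HahnSeries.coeff_eq_zero_of_lt_order, zero_mul]
      by_contra h
      exact hj ⟨(j - o).toNat, by simp; omega⟩)).2 hs
    rw [← (h1.mul_right (ξ ^ o)).tsum_eq]
    refine tsum_congr fun i => ?_
    simp only [Function.comp, hfdef, LaurentSeries.powerSeriesPart_coeff]
    rw [neg_add, zpow_add₀ hξ0, zpow_neg, zpow_neg, zpow_natCast, inv_pow]
    have := zpow_ne_zero o hξ0
    field_simp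
    rfl
  refine Tendsto.congr' hev ?_
  have hlim : ∑' i : ℕ, PowerSeries.coeff i f * (0 : ℂ) ^ i = s.coeff.coeff o := by
    rw [tsum_eq_single 0 fun i hi => by simp [hi]]
    simp [hfdef, LaurentSeries.powerSeriesPart_coeff, o, -PowerSeries.coeff_zero_eq_constantCoeff]
  rw [← hlim]
  refine tendsto_tsum_of_dominated_convergence (bound := fun i => B * (1 / 2) ^ i)
    (summable_geometric_two.mul_left _)
    (fun i => (tendsto_inv₀_cobounded.pow i).const_mul _) ?_
  filter_upwards [eventually_cobounded_le_norm (2 * C)] with ξ hξ i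
  have h1 : ‖ξ‖⁻¹ ≤ (2 * C)⁻¹ := by gcongr
  rw [norm_mul, norm_pow, norm_inv]
  calc _ ≤ B * C ^ i * (2 * C)⁻¹ ^ i := by
        gcongr
        exact hf i
    _ = _ := by
        have : C ≠ 0 := by positivity
        rw [mul_inv, mul_pow, inv_pow C]
        field_simp

theorem Symbol.HasPoleOrder.coeff_ne_zero {κ : ℕ} {s : Symbol} {q : ℚ}
    (h : s.HasPoleOrder κ q) : s.coeff ≠ 0 := by
  rintro h0
  obtain ⟨N, -, c, hc, hlim⟩ := h
  refine hc (tendsto_nhds_unique hlim (tendsto_const_nhds.congr' ?_))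
  filter_upwards [s.hasSum] with ξ hξ
  simp only [h0, HahnSeries.coeff_zero, zero_mul] at hξ
  rw [hξ.unique hasSum_zero, zero_div]

/-- A pole of order above `N` would force the leading coefficient to be the limit of a bounded
quantity times a positive power of `ξ⁻¹`, hence zero. Upper bounds on growth need only this
inequality. -/
theorem Symbol.HasPoleOrder.neg_le_order {κ : ℕ} {s : Symbol} {q : ℚ}
    (h : s.HasPoleOrder κ q) : ∃ N : ℤ, (N : ℚ) = q * κ ∧ -N ≤ s.coeff.order := by
  have h0 := h.coeff_ne_zero
  obtain ⟨N, hN, c, hc, hlim⟩ := h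
  refine ⟨N, hN, ?_⟩
  by_contra hlt
  obtain ⟨e, he⟩ : ∃ e : ℕ, N + s.coeff.order = -((e : ℤ) + 1) :=
    ⟨(-(N + s.coeff.order) - 1).toNat, by omega⟩
  have h1 : Tendsto (fun ξ : ℂ => s.toFun ξ / ξ ^ N * (ξ⁻¹) ^ (e + 1)) (Bornology.cobounded ℂ)
      (𝓝 (c * 0 ^ (e + 1))) := hlim.mul (tendsto_inv₀_cobounded.pow _)
  rw [zero_pow (Nat.succ_ne_zero e), mul_zero] at h1
  have h2 := tendsto_nhds_unique s.tendsto_mul_zpow_order (h1.congr' ?_)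
  · exact HahnSeries.coeff_order_eq_zero.not.2 h0 h2
  · filter_upwards [eventually_cobounded_le_norm (1 : ℝ)] with ξ hξ
    have hξ0 : ξ ≠ 0 := norm_pos_iff.1 (by linarith)
    rw [show s.coeff.order = -N + -((e : ℤ) + 1) by omega, zpow_add₀ hξ0, zpow_neg, zpow_neg,
      inv_pow, div_eq_mul_inv, mul_assoc]
    norm_cast

/-! ### Factorials and the Gamma function -/

theorem factorial_add_le (a b : ℕ) :
    (a + b).factorial ≤ 2 ^ (a + b) * (a.factorial * b.factorial) := by
  rw [← Nat.add_choose_mul_factorial_mul_factorial, mul_assoc]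
  exact Nat.mul_le_mul_right _ (Nat.choose_le_two_pow _ _)

theorem exists_factorial_mul_le (N : ℕ) :
    ∃ C : ℕ, 1 ≤ C ∧ ∀ n : ℕ, (n * N).factorial ≤ C ^ n * n.factorial ^ N := by
  induction N with
  | zero => exact ⟨1, le_rfl, by simp⟩
  | succ N ih =>
    obtain ⟨C, hC, h⟩ := ih
    refine ⟨2 ^ (N + 1) * C, Nat.one_le_iff_ne_zero.2 (by positivity), fun n => ?_⟩
    calc (n * (N + 1)).factorial
        ≤ 2 ^ (n * N + n) * ((n * N).factorial * n.factorial) := factorial_add_le _ _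
      _ ≤ 2 ^ (n * N + n) * (C ^ n * n.factorial ^ N * n.factorial) := by
          gcongr
          exact h n
      _ = _ := by
          rw [mul_pow, ← pow_mul, show n * N + n = (N + 1) * n by ring, pow_succ n.factorial N]
          ring

theorem factorial_pow_le_factorial_mul (n N : ℕ) : n.factorial ^ N ≤ (N * n).factorial := by
  induction N with
  | zero => simp
  | succ N ih =>
    rw [pow_succ, Nat.succ_mul]
    exact (Nat.mul_le_mul_right _ ih).trans (Nat.le_of_dvd (Nat.factorial_pos _)
      (Nat.factorial_mul_factorial_dvd_factorial_add _ _))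

theorem factorial_le_two_mul_Gamma {x : ℝ} {t : ℕ} (h1 : (t : ℝ) ≤ x) (h2 : x ≤ t + 1) :
    (t.factorial : ℝ) ≤ 2 * Real.Gamma (1 + x) := by
  have ht : (0 : ℝ) ≤ t := Nat.cast_nonneg t
  -- Monotonicity of Gamma is available from 2 on, hence the shift by one; undoing it costs `(1 +
  -- x)/(t + 1) ≤ 2`.
  have h3 : Real.Gamma ((t + 1 : ℕ) + 1) ≤ Real.Gamma (1 + x + 1) := by
    refine Real.Gamma_strictMonoOn_Ici.monotoneOn ?_ ?_ ?_
    · simp only [Set.mem_Ici]; push_cast; linarith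
    · simp only [Set.mem_Ici]; linarith
    · push_cast; linarith
  rw [Real.Gamma_nat_eq_factorial, Real.Gamma_add_one (by linarith), Nat.factorial_succ] at h3
  push_cast at h3
  have h4 : 0 < Real.Gamma (1 + x) := Real.Gamma_pos_of_pos (by linarith)
  have h5 : ((t : ℝ) + 1) * t.factorial ≤ (t + 1) * (2 * Real.Gamma (1 + x)) := by nlinarith
  exact le_of_mul_le_mul_left h5 (by linarith)

/-- With `t = ⌊b/κ⌋`, one compares `b!` with `((t+1)κ)!`, which is `((t+1)!)^κ` up to a geometric
factor, and `t!` with the Gamma value. -/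
theorem exists_factorial_rpow_le_Gamma {κ : ℕ} (hκ : 0 < κ) :
    ∃ C : ℝ, 1 ≤ C ∧ ∀ b : ℕ,
      (b.factorial : ℝ) ^ (1 / (κ : ℝ)) ≤ C ^ (b + 1) * Real.Gamma (1 + (b : ℝ) / κ) := by
  obtain ⟨C, hC, h⟩ := exists_factorial_mul_le κ
  have hC' : (1 : ℝ) ≤ C := by exact_mod_cast hC
  refine ⟨4 * C, by linarith, fun b => ?_⟩
  set t := b / κ with ht
  have hκ' : (0 : ℝ) < κ := by exact_mod_cast hκ
  have hlt : b < (t + 1) * κ := Nat.lt_mul_of_div_lt (Nat.lt_succ_self t) hκ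
  have hle : t * κ ≤ b := Nat.div_mul_le_self b κ
  have htb : t ≤ b := Nat.div_le_self b κ
  have hG : (t.factorial : ℝ) ≤ 2 * Real.Gamma (1 + (b : ℝ) / κ) := by
    refine factorial_le_two_mul_Gamma ?_ ?_
    · rw [le_div_iff₀ hκ']; exact_mod_cast hle
    · rw [div_le_iff₀ hκ']; exact_mod_cast hlt.le
  have h1 : b.factorial ≤ (C ^ (t + 1) * (t + 1).factorial) ^ κ := by
    refine (Nat.factorial_le hlt.le).trans ((h _).trans ?_)
    rw [mul_pow]
    exact Nat.mul_le_mul_right _ (Nat.le_self_pow hκ.ne' _)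
  have h2 : (b.factorial : ℝ) ^ (1 / (κ : ℝ)) ≤ (C : ℝ) ^ (t + 1) * (t + 1).factorial := by
    rw [one_div]
    calc _ ≤ (((C : ℝ) ^ (t + 1) * (t + 1).factorial) ^ κ) ^ ((κ : ℝ)⁻¹) :=
          Real.rpow_le_rpow (by positivity) (by exact_mod_cast h1) (by positivity)
      _ = _ := Real.pow_rpow_inv_natCast (by positivity) hκ.ne'
  have h3 : ((t + 1 : ℕ) : ℝ) ≤ 2 ^ (b + 1) := by
    exact_mod_cast (Nat.lt_two_pow_self.le.trans (Nat.pow_le_pow_right two_pos (by omega)))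
  have hG0 : 0 ≤ Real.Gamma (1 + (b : ℝ) / κ) := by
    have : (0 : ℝ) ≤ t.factorial := by positivity
    linarith
  calc _ ≤ (C : ℝ) ^ (t + 1) * (t + 1).factorial := h2
    _ = (C : ℝ) ^ (t + 1) * ((t + 1 : ℕ) * t.factorial) := by rw [Nat.factorial_succ]; push_cast; rfl
    _ ≤ (C : ℝ) ^ (b + 1) * (2 ^ (b + 1) * (2 ^ (b + 1) * Real.Gamma (1 + (b : ℝ) / κ))) := by
        gcongr
        refine hG.trans (mul_le_mul_of_nonneg_right ?_ hG0)
        exact le_self_pow₀ one_le_two (Nat.succ_ne_zero b)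
    _ = _ := by
        rw [show (4 : ℝ) = 2 * 2 by norm_num, mul_pow, mul_pow]; ring

/-- Separates the dependence on `b` from that on `n`. The exponent of `b!` is raised to `τ` so that,
with `τ = 1/κ`, Gamma can absorb it; `σ ≤ 1` keeps the geometric factors simple. -/
theorem exists_factorial_rpow_le {N K : ℕ} {σ τ : ℝ} (hσ : 0 ≤ σ) (hσ1 : σ ≤ 1) (hστ : σ ≤ τ) :
    ∃ A B : ℝ, 0 ≤ A ∧ 0 ≤ B ∧ ∀ n b : ℕ, ((b + n * N + K).factorial : ℝ) ^ σ ≤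
      B * A ^ n * 4 ^ b * (b.factorial : ℝ) ^ τ * (n.factorial : ℝ) ^ (N * σ) := by
  obtain ⟨C, hC, h⟩ := exists_factorial_mul_le N
  refine ⟨4 ^ N * C, 4 ^ K * K.factorial, by positivity, by positivity, fun n b => ?_⟩
  have h1 : (b + n * N + K).factorial ≤
      (4 ^ (b + n * N + K) * C ^ n * K.factorial) * b.factorial * n.factorial ^ N := by
    calc _ ≤ 2 ^ (b + n * N + K) * ((b + n * N).factorial * K.factorial) := factorial_add_le _ _
      _ ≤ 2 ^ (b + n * N + K) * ((2 ^ (b + n * N) * (b.factorial * (n * N).factorial)) *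
            K.factorial) := by
          gcongr
          exact factorial_add_le _ _
      _ ≤ 2 ^ (b + n * N + K) * ((2 ^ (b + n * N + K) * (b.factorial * (C ^ n * n.factorial ^ N))) *
            K.factorial) := by
          have h2 : 2 ^ (b + n * N) ≤ 2 ^ (b + n * N + K) :=
            Nat.pow_le_pow_right two_pos (Nat.le_add_right _ _)
          exact Nat.mul_le_mul_left _ (Nat.mul_le_mul_right _
            (Nat.mul_le_mul h2 (Nat.mul_le_mul_left _ (h n))))
      _ = _ := by
          rw [show (4 : ℕ) = 2 * 2 by norm_num, mul_pow]; ring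
  have hX : (1 : ℝ) ≤ 4 ^ (b + n * N + K) * C ^ n * K.factorial := by
    have : 1 ≤ 4 ^ (b + n * N + K) * C ^ n * K.factorial :=
      Nat.one_le_iff_ne_zero.2 (by positivity)
    exact_mod_cast this
  have hb : (1 : ℝ) ≤ b.factorial := by
    exact_mod_cast Nat.one_le_iff_ne_zero.2 (Nat.factorial_ne_zero b)
  calc ((b + n * N + K).factorial : ℝ) ^ σ
      ≤ ((4 ^ (b + n * N + K) * C ^ n * K.factorial : ℝ) * b.factorial * n.factorial ^ N) ^ σ :=
        Real.rpow_le_rpow (by positivity) (by exact_mod_cast h1) hσ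
    _ = (4 ^ (b + n * N + K) * C ^ n * K.factorial : ℝ) ^ σ * (b.factorial : ℝ) ^ σ *
          (n.factorial : ℝ) ^ (N * σ) := by
        rw [Real.mul_rpow (by positivity) (by positivity),
          Real.mul_rpow (by positivity) (by positivity), Real.rpow_mul (by positivity),
          Real.rpow_natCast]
    _ ≤ (4 ^ (b + n * N + K) * C ^ n * K.factorial : ℝ) * (b.factorial : ℝ) ^ τ *
          (n.factorial : ℝ) ^ (N * σ) := by
        gcongr
        exact (Real.rpow_le_rpow_of_exponent_le hX hσ1).trans_eq (Real.rpow_one _)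
    _ = _ := by
        rw [pow_add, pow_add, mul_pow, ← pow_mul, mul_comm N n]; ring

/-! ### Coefficients of the elementary solutions -/

/-- The main estimate: each factor `λ` raises the index read from the product of power series parts
by at most `N`. The part of the factorial growing with `b` cancels against Gamma, and `(n!)^{Nσ}`
remains. -/
theorem exists_norm_coeff_pow_mul_le {κ : ℕ} (hκ : 0 < κ) (s : Symbol) {N : ℕ}
    (hN : -(N : ℤ) ≤ s.coeff.order) {σ : ℝ} (hσ : 0 ≤ σ) (hσκ : σ ≤ 1 / (κ : ℝ))
    {F : GenSeries} (hF : IsTame σ F) :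
    ∃ A B D : ℝ, 0 ≤ A ∧ 0 ≤ B ∧ 0 < D ∧ ∀ n b : ℕ,
      ‖(s.coeff ^ n * F).coeff (b : ℤ) / (Real.Gamma (1 + (b : ℝ) / κ) : ℂ)‖ ≤
        B * A ^ n * D ^ b * (n.factorial : ℝ) ^ (N * σ) := by
  obtain ⟨A₀, C₀, hA₀, hC₀, hf⟩ := s.exists_norm_coeff_le
  obtain ⟨k, g, ⟨B₁, D₁, hB₁, hD₁, hg⟩, rfl⟩ := hF
  have hκ1 : 1 / (κ : ℝ) ≤ 1 := by
    rw [div_le_one (by exact_mod_cast hκ)]; exact_mod_cast hκ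
  obtain ⟨A₂, B₂, hA₂, hB₂, h₂⟩ := exists_factorial_rpow_le (N := N) (K := k.natAbs) hσ
    (hσκ.trans hκ1) hσκ
  obtain ⟨C₃, hC₃, h₃⟩ := exists_factorial_rpow_le_Gamma hκ
  set f := s.coeff.powerSeriesPart
  set o := s.coeff.order
  set D := 2 * C₀ + D₁ with hD
  have hD1 : 1 ≤ D := by linarith
  have hpow : ∀ n : ℕ, s.coeff ^ n *
      (HahnSeries.single k 1 * HahnSeries.ofPowerSeries ℤ ℂ g) =
      HahnSeries.single ((n : ℤ) * o + k) 1 * HahnSeries.ofPowerSeries ℤ ℂ (f ^ n * g) := by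
    intro n
    have h1 : (HahnSeries.single ((n : ℤ) * o + k) 1 : LaurentSeries ℂ) =
        HahnSeries.single o 1 ^ n * HahnSeries.single k 1 := by
      rw [HahnSeries.single_pow, HahnSeries.single_mul_single]
      simp
    rw [h1, map_mul, map_pow]
    conv_lhs => rw [← LaurentSeries.single_order_mul_powerSeriesPart s.coeff]
    rw [mul_pow]
    ring
  have hbound := norm_coeff_pow_mul_le (f := f) (g := g) (C := C₀) (D := D)
    (factorial_rpow_monotone hσ) (fun i => by positivity) hA₀ hB₁ (by linarith) (by linarith) hf
    fun i => (hg i).trans (by gcongr; linarith)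
  refine ⟨2 * A₀ * D ^ N * A₂, B₁ * D ^ k.natAbs * B₂ * C₃, D * 4 * C₃, by positivity,
    by positivity, by positivity, fun n b => ?_⟩
  have hG : 0 < Real.Gamma (1 + (b : ℝ) / κ) := Real.Gamma_pos_of_pos (by positivity)
  rw [norm_div, Complex.norm_real, Real.norm_of_nonneg hG.le, div_le_iff₀ hG, hpow,
    coeff_single_mul_ofPowerSeries]
  split_ifs with hlt
  · rw [norm_zero]; positivity
  have he : ((b : ℤ) - (n * o + k)).toNat ≤ b + n * N + k.natAbs := by
    have : (n : ℤ) * -(N : ℤ) ≤ n * o := mul_le_mul_of_nonneg_left hN (by positivity)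
    have h4 : ((b : ℤ) - (n * o + k)) ≤ ((b + n * N + k.natAbs : ℕ) : ℤ) := by
      push_cast
      have := neg_abs_le k
      linarith
    omega
  calc _ ≤ (2 * A₀) ^ n * B₁ * D ^ ((b : ℤ) - (n * o + k)).toNat *
        ((((b : ℤ) - (n * o + k)).toNat).factorial : ℝ) ^ σ := hbound n _
    _ ≤ (2 * A₀) ^ n * B₁ * D ^ (b + n * N + k.natAbs) *
        ((b + n * N + k.natAbs).factorial : ℝ) ^ σ := by
        gcongr
    _ ≤ (2 * A₀) ^ n * B₁ * D ^ (b + n * N + k.natAbs) * (B₂ * A₂ ^ n * 4 ^ b *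
          (C₃ ^ (b + 1) * Real.Gamma (1 + (b : ℝ) / κ)) * (n.factorial : ℝ) ^ (N * σ)) := by
        refine mul_le_mul_of_nonneg_left ((h₂ n b).trans ?_) (by positivity)
        gcongr
        exact h₃ b
    _ = _ := by
        rw [pow_add, pow_add, mul_comm n N, pow_mul, pow_succ C₃]
        simp only [mul_pow]
        ring

theorem exists_norm_coeff_elementarySolution_le {κ : ℕ} (hκ : 0 < κ) {m : ℕ → ℝ}
    (hm : ∀ i, 0 < m i) (hmG : PreservesGevreyOrder m) (s : Symbol) {N : ℕ}
    (hN : -(N : ℤ) ≤ s.coeff.order) {σ : ℝ} (hσ : 0 ≤ σ) (hσκ : σ ≤ 1 / (κ : ℝ))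
    {F : GenSeries} (hF : IsTame σ F) (a : ℕ) :
    ∃ A B D : ℝ, 0 ≤ A ∧ 0 ≤ B ∧ 0 < D ∧ ∀ n b : ℕ,
      ‖(elementarySolution m s a F n).coeff (b : ℤ) / (Real.Gamma (1 + (b : ℝ) / κ) : ℂ)‖ ≤
        B * A ^ n * D ^ b * (n.factorial : ℝ) ^ (N * σ) := by
  obtain ⟨A, B, D, hA, hB, hD, h⟩ := exists_norm_coeff_pow_mul_le hκ s hN hσ hσκ hF
  -- Preservation of order `0`, applied to the series with all coefficients `1`, bounds `1/m(n)`
  -- geometrically.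
  obtain ⟨B', C', h'⟩ := (hmG ℂ 0 fun _ => 1).1 ⟨1, 1, fun n => by simp⟩
  have hm' : ∀ n, (m n)⁻¹ ≤ |B'| * |C'| ^ n := fun n => by
    have := h' n
    simp only [borel, smul_eq_mul, mul_one, norm_inv, Complex.norm_real,
      Real.norm_of_nonneg (hm n).le, Real.rpow_zero] at this
    refine this.trans ((le_abs_self _).trans_eq ?_)
    rw [abs_mul, abs_pow]
  refine ⟨2 * |C'| * A, |B'| * B, D, by positivity, by positivity, hD, fun n b => ?_⟩
  have hmn := hm n
  have h1 : ‖((n.choose a / m n : ℝ) : ℂ)‖ ≤ 2 ^ n * (|B'| * |C'| ^ n) := by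
    rw [Complex.norm_real, Real.norm_of_nonneg (by positivity), div_eq_mul_inv]
    have : (n.choose a : ℝ) ≤ 2 ^ n := by exact_mod_cast Nat.choose_le_two_pow n a
    gcongr
    exact hm' n
  rw [elementarySolution, HahnSeries.coeff_smul, smul_eq_mul, mul_div_assoc, norm_mul]
  calc _ ≤ (2 ^ n * (|B'| * |C'| ^ n)) * (B * A ^ n * D ^ b * (n.factorial : ℝ) ^ (N * σ)) :=
        mul_le_mul h1 (h n b) (norm_nonneg _) (by positivity)
    _ = _ := by simp only [mul_pow]; ring

/-! ### Sums of power series with uniform bounds -/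

theorem norm_term_le {B D : ℝ} (hB : 0 ≤ B) (hD : 0 < D) {c : ℕ → ℂ} (hc : ∀ b, ‖c b‖ ≤ B * D ^ b)
    {x : ℂ} (hx : x ∈ Metric.ball (0 : ℂ) (1 / (2 * D))) (b : ℕ) :
    ‖c b * x ^ b‖ ≤ B * (1 / 2) ^ b := by
  rw [mem_ball_zero_iff] at hx
  rw [norm_mul, norm_pow]
  calc _ ≤ B * D ^ b * (1 / (2 * D)) ^ b := by
        gcongr
        exact hc b
    _ = _ := by
        rw [mul_assoc, ← mul_pow]
        congr 2
        field_simp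

theorem summable_of_norm_coeff_le {B D : ℝ} (hB : 0 ≤ B) (hD : 0 < D) {c : ℕ → ℂ}
    (hc : ∀ b, ‖c b‖ ≤ B * D ^ b) {x : ℂ} (hx : x ∈ Metric.ball (0 : ℂ) (1 / (2 * D))) :
    Summable fun b => c b * x ^ b :=
  Summable.of_norm_bounded (summable_geometric_two.mul_left B) (norm_term_le hB hD hc hx)

theorem norm_tsum_le_of_norm_coeff_le {B D : ℝ} (hB : 0 ≤ B) (hD : 0 < D) {c : ℕ → ℂ}
    (hc : ∀ b, ‖c b‖ ≤ B * D ^ b) {x : ℂ} (hx : x ∈ Metric.ball (0 : ℂ) (1 / (2 * D))) :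
    ‖∑' b, c b * x ^ b‖ ≤ 2 * B := by
  refine (tsum_of_norm_bounded (hasSum_geometric_two.mul_left B)
    (norm_term_le hB hD hc hx)).trans_eq (mul_comm _ _)

theorem differentiableOn_tsum_of_norm_coeff_le {B D : ℝ} (hB : 0 ≤ B) (hD : 0 < D) {c : ℕ → ℂ}
    (hc : ∀ b, ‖c b‖ ≤ B * D ^ b) :
    DifferentiableOn ℂ (fun x => ∑' b, c b * x ^ b) (Metric.ball (0 : ℂ) (1 / (2 * D))) :=
  Complex.differentiableOn_tsum_of_summable_norm (summable_geometric_two.mul_left B)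
    (fun b => by fun_prop) Metric.isOpen_ball fun b x hx => norm_term_le hB hD hc hx b

theorem isGevreyInT_of_norm_coeff_le {τ A B D : ℝ} (hA : 0 ≤ A) (hB : 0 ≤ B) (hD : 0 < D)
    {c : ℕ → ℕ → ℂ} (hc : ∀ n b, ‖c n b‖ ≤ B * A ^ n * D ^ b * (n.factorial : ℝ) ^ τ) :
    IsGevreyInT τ fun n x => ∑' b, c n b * x ^ b := by
  have hc' : ∀ n b, ‖c n b‖ ≤ (B * A ^ n * (n.factorial : ℝ) ^ τ) * D ^ b := fun n b =>
    (hc n b).trans_eq (by ring)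
  have hlt : 1 / (4 * D) < 1 / (2 * D) := by
    apply one_div_lt_one_div_of_lt <;> linarith
  -- Half the radius on which the sums are known to be holomorphic, to have continuity up to the
  -- boundary.
  refine ⟨1 / (4 * D), by positivity, fun n => ?_, 2 * B, A, fun n x hx => ?_⟩
  · exact (differentiableOn_tsum_of_norm_coeff_le (by positivity) hD (hc' n)).diffContOnCl_ball
      (Metric.closedBall_subset_ball hlt)
  · refine (norm_tsum_le_of_norm_coeff_le (by positivity) hD (hc' n)
      (Metric.ball_subset_ball hlt.le hx)).trans_eq (by ring)

/-! ### Taylor coefficients of the initial data -/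

/-- The `i`-th derivative sits at index `κ i`, and `(i!)^κ ≤ (κ i)!`; hence the exponent is divided
by `κ`. -/
theorem isTame_ofGerm {κ : ℕ} (hκ : 0 < κ) {s : ℝ} (hs : 0 ≤ s) {φ : ℂ → ℂ} {B C : ℝ}
    (hB : 0 ≤ B) (hC : 1 ≤ C)
    (h : ∀ i : ℕ, ‖iteratedDeriv i φ 0‖ ≤ B * C ^ i * (i.factorial : ℝ) ^ s) :
    IsTame (s / κ) (ofGerm κ φ) := by
  refine ⟨0, _, ⟨B, C, hB, hC, fun b => ?_⟩, (by simp [ofGerm]; rfl)⟩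
  rw [PowerSeries.coeff_mk]
  split_ifs with hd
  · obtain ⟨i, rfl⟩ := hd
    rw [Nat.mul_div_cancel_left i hκ]
    refine (h i).trans ?_
    have hκ' : (κ : ℝ) ≠ 0 := by exact_mod_cast hκ.ne'
    have h1 : (i.factorial : ℝ) ^ s ≤ ((κ * i).factorial : ℝ) ^ (s / κ) := by
      calc (i.factorial : ℝ) ^ s = ((i.factorial : ℝ) ^ κ) ^ (s / κ) := by
            rw [← Real.rpow_natCast, ← Real.rpow_mul (by positivity), mul_div_cancel₀ _ hκ']
        _ ≤ _ := Real.rpow_le_rpow (by positivity)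
            (by exact_mod_cast factorial_pow_le_factorial_mul i κ) (by positivity)
    gcongr
    exact Nat.le_mul_of_pos_left i hκ
  · rw [norm_zero]; positivity

theorem isTame_ofGerm_of_differentiableOn {κ : ℕ} (hκ : 0 < κ) {φ : ℂ → ℂ} {r : ℝ} (hr : 0 < r)
    (hφ : DifferentiableOn ℂ φ (Metric.ball 0 r)) : IsTame (1 / κ) (ofGerm κ φ) := by
  have hsub : Metric.closedBall (0 : ℂ) (r / 2) ⊆ Metric.ball 0 r :=
    Metric.closedBall_subset_ball (by linarith)
  obtain ⟨M, hM⟩ := (isCompact_closedBall (0 : ℂ) (r / 2)).exists_bound_of_continuousOn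
    (hφ.continuousOn.mono hsub)
  have hM0 : 0 ≤ M := (norm_nonneg _).trans (hM 0 (Metric.mem_closedBall_self (by linarith)))
  refine isTame_ofGerm hκ zero_le_one (B := M) (C := max 1 (2 / r)) hM0 (le_max_left _ _)
    fun i => ?_
  have h1 := Complex.norm_iteratedDeriv_le_of_forall_mem_sphere_norm_le i (half_pos hr)
    (hφ.diffContOnCl_ball hsub) fun z hz => hM z (Metric.sphere_subset_closedBall hz)
  calc _ ≤ i.factorial * M / (r / 2) ^ i := h1
    _ = M * (2 / r) ^ i * (i.factorial : ℝ) ^ (1 : ℝ) := by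
        rw [Real.rpow_one, div_pow, div_pow]; field_simp
    _ ≤ _ := by
        gcongr
        exact le_max_right _ _

/-- Cauchy's estimate on the circle of radius `R = i^{1/K}`, `K = max k 1`: there `exp(B R^K)` is
geometric in `i`, while `R^i ≥ (i!)^{1/K}` provides the gain. -/
theorem isTame_ofGerm_of_isEntireOfGrowth {κ : ℕ} (hκ : 0 < κ) {φ : ℂ → ℂ} {k : ℝ} (hk : 0 < k)
    (hφ : IsEntireOfGrowth k φ) : IsTame (max (1 - 1 / k) 0 / κ) (ofGerm κ φ) := by
  obtain ⟨hd, A, hA, B, hB, h⟩ := hφ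
  set K := max k 1 with hK
  have hK0 : 0 < K := by positivity
  have hs : max (1 - 1 / k) 0 = 1 - 1 / K := by
    rcases le_total k 1 with h1 | h1
    · rw [hK, max_eq_right h1, max_eq_right]
      · simp
      · have : 1 ≤ 1 / k := by rwa [le_div_iff₀ hk, one_mul]
        linarith
    · rw [hK, max_eq_left h1, max_eq_left]
      have : 1 / k ≤ 1 := by rwa [div_le_one hk]
      linarith
  have hgrowth : ∀ R : ℝ, 0 < R → R ^ k ≤ 1 + R ^ K := fun R hR => by
    have h0 : 0 ≤ R ^ K := by positivity
    rcases le_total R 1 with h1 | h1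
    · have := Real.rpow_le_one hR.le h1 hk.le
      linarith
    · have := Real.rpow_le_rpow_of_exponent_le h1 (le_max_left k 1)
      linarith
  refine isTame_ofGerm hκ (le_max_right _ _) (B := A * Real.exp B) (C := Real.exp B)
    (by positivity) (Real.one_le_exp hB.le) fun i => ?_
  rw [hs]
  -- For `i = 0` the chosen radius would be zero.
  rcases Nat.eq_zero_or_pos i with rfl | hi
  · have := h 0
    simp only [norm_zero, Real.zero_rpow hk.ne', mul_zero, Real.exp_zero, mul_one] at this
    simp only [iteratedDeriv_zero, pow_zero, mul_one, Nat.factorial_zero, Nat.cast_one,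
      Real.one_rpow]
    have h2 := Real.one_le_exp hB.le
    nlinarith
  have hi' : (0 : ℝ) < i := by exact_mod_cast hi
  set R : ℝ := (i : ℝ) ^ (1 / K) with hR
  have hR0 : 0 < R := by positivity
  have hRK : R ^ K = i := by
    rw [hR, ← Real.rpow_mul hi'.le, one_div, inv_mul_cancel₀ hK0.ne', Real.rpow_one]
  have h1 := Complex.norm_iteratedDeriv_le_of_forall_mem_sphere_norm_le
    (C := A * Real.exp (B * (1 + i))) i hR0 hd.diffContOnCl fun z hz => by
      rw [mem_sphere_zero_iff_norm] at hz
      refine (h z).le.trans ?_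
      rw [hz]
      gcongr
      exact (hgrowth R hR0).trans_eq (by rw [hRK])
  have h2 : (i.factorial : ℝ) ^ (1 / K) ≤ R ^ i := by
    rw [hR, ← Real.rpow_natCast, ← Real.rpow_mul hi'.le, mul_comm, Real.rpow_mul hi'.le,
      Real.rpow_natCast]
    exact Real.rpow_le_rpow (by positivity) (by exact_mod_cast Nat.factorial_le_pow i)
      (by positivity)
  have hf0 : (0 : ℝ) < i.factorial := by positivity
  calc _ ≤ i.factorial * (A * Real.exp (B * (1 + i))) / R ^ i := h1
    _ ≤ i.factorial * (A * Real.exp (B * (1 + i))) / (i.factorial : ℝ) ^ (1 / K) := by gcongr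
    _ = _ := by
        rw [Real.rpow_sub hf0, Real.rpow_one, mul_add, mul_one, Real.exp_add, ← Real.exp_nat_mul,
          mul_comm (i : ℝ) B]
        ring

/-! ### The decomposition -/

/-- The system is solved over the convergent subfield rather than over all Laurent series, so that
the entries of the inverse are again symbols. -/
theorem exists_decomposition_symbols {P : ℂ[X][X]} {κ n : ℕ} {pn : Fin n → ℕ}
    {lam : (j : Fin n) → Fin (pn j) → Symbol} {mult : (j : Fin n) → Fin (pn j) → ℕ}
    {q : Fin n → ℚ} (hfac : IsFactorization P κ pn lam mult q) :
    ∃ d : (j : Fin n) → (l : Fin (pn j)) → Fin (mult j l) → Fin P.natDegree → Symbol,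
      ∀ β γ : Fin P.natDegree, ∑ j, ∑ l, ∑ a : Fin (mult j l),
        (((β : ℕ).choose a : ℕ) : LaurentSeries ℂ) * (lam j l).coeff ^ (β : ℕ) *
          (d j l a γ).coeff = if β = γ then 1 else 0 := by
  let mu : (Σ j : Fin n, Fin (pn j)) → convergentSubfield := fun i =>
    ⟨(lam i.1 i.2).coeff, (lam i.1 i.2).isTame_coeff⟩
  obtain ⟨d, hd⟩ := exists_confluentVandermonde_inverse mu
    (fun i i' h => hfac.distinct (congrArg Subtype.val h))
    (fun i h => (hfac.asymp i.1 i.2).coeff_ne_zero (congrArg Subtype.val h))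
    (fun i => mult i.1 i.2) P.natDegree (by rw [← hfac.sum_mult, Fintype.sum_sigma])
  choose S hS using fun F : convergentSubfield => IsTame.exists_symbol F.2
  refine ⟨fun j l a γ => S (d ⟨⟨j, l⟩, a⟩ γ), fun β γ => ?_⟩
  have h := congrArg Subtype.val (hd β γ)
  simp only [Fintype.sum_sigma] at h
  simp only [hS]
  rw [apply_ite Subtype.val] at h
  simpa [mu] using h

/-- The Gevrey order produced by the coefficient bounds. -/
theorem toNat_mul_div_eq {κ : ℕ} (hκ : 0 < κ) {q : ℚ} {N : ℤ} (hN : (N : ℚ) = q * κ) (s : ℝ) :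
    (N.toNat : ℝ) * (s / κ) = max (q : ℝ) 0 * s := by
  have hκ' : (0 : ℝ) < κ := by exact_mod_cast hκ
  have hN' : (N : ℝ) = q * κ := by exact_mod_cast hN
  have h1 : (N.toNat : ℝ) = max (N : ℝ) 0 := by
    rw [← Int.cast_natCast, Int.toNat_eq_max]; push_cast; rfl
  rw [h1, hN', show max ((q : ℝ) * κ) 0 = max (q : ℝ) 0 * κ by
    rw [max_mul_of_nonneg _ _ hκ'.le, zero_mul]]
  field_simp

/-- The sum of the ordinary part of a formal sum. -/
def regularPart (κ : ℕ) (F : GenSeries) (x : ℂ) : ℂ :=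
  ∑' b : ℕ, F.coeff (b : ℤ) / (Real.Gamma (1 + (b : ℝ) / κ) : ℂ) * x ^ b

theorem exists_norm_coeff_elementarySolution_le_of_hasPoleOrder {κ : ℕ} (hκ : 0 < κ) {m : ℕ → ℝ}
    (hm : ∀ i, 0 < m i) (hmG : PreservesGevreyOrder m) {lam : Symbol} {q : ℚ}
    (hq : lam.HasPoleOrder κ q) {s : ℝ} (hs : 0 ≤ s) (hs1 : s ≤ 1) {F : GenSeries}
    (hF : IsTame (s / κ) F) (a : ℕ) :
    ∃ A B D : ℝ, 0 ≤ A ∧ 0 ≤ B ∧ 0 < D ∧ ∀ n b : ℕ,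
      ‖(elementarySolution m lam a F n).coeff (b : ℤ) / (Real.Gamma (1 + (b : ℝ) / κ) : ℂ)‖ ≤
        B * A ^ n * D ^ b * (n.factorial : ℝ) ^ (max (q : ℝ) 0 * s) := by
  -- `N` may be negative; replacing it by `N.toNat` only weakens the bound on the order and produces
  -- `max q 0`.
  obtain ⟨N, hN, hord⟩ := hq.neg_le_order
  rw [← toNat_mul_div_eq hκ hN s]
  exact exists_norm_coeff_elementarySolution_le hκ hm hmG lam (by omega) (by positivity)
    (by gcongr) hF a

theorem isGevreyInT_regularPart_elementarySolution {κ : ℕ} (hκ : 0 < κ) {m : ℕ → ℝ}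
    (hm : ∀ i, 0 < m i) (hmG : PreservesGevreyOrder m) {lam : Symbol} {q : ℚ}
    (hq : lam.HasPoleOrder κ q) {s : ℝ} (hs : 0 ≤ s) (hs1 : s ≤ 1) {F : GenSeries}
    (hF : IsTame (s / κ) F) (a : ℕ) :
    IsGevreyInT (max (q : ℝ) 0 * s) fun n => regularPart κ (elementarySolution m lam a F n) := by
  obtain ⟨A, B, D, hA, hB, hD, h⟩ :=
    exists_norm_coeff_elementarySolution_le_of_hasPoleOrder hκ hm hmG hq hs hs1 hF a
  exact isGevreyInT_of_norm_coeff_le hA hB hD h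

theorem isTame_sum_op {κ p : ℕ} {σ : ℝ} (hσ : 0 ≤ σ) (d : Fin p → Symbol) {φ : Fin p → ℂ → ℂ}
    (hφ : ∀ γ, IsTame σ (ofGerm κ (φ γ))) : IsTame σ (∑ γ, (d γ).op (ofGerm κ (φ γ))) :=
  IsTame.sum hσ _ fun γ _ => (d γ).isTame_coeff.mul hσ (hφ γ)

theorem isRegularPart_regularPart {κ : ℕ} {F : GenSeries} {B D : ℝ} (hB : 0 ≤ B) (hD : 0 < D)
    (h : ∀ b : ℕ, ‖F.coeff (b : ℤ) / (Real.Gamma (1 + (b : ℝ) / κ) : ℂ)‖ ≤ B * D ^ b) :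
    IsRegularPart κ F (regularPart κ F) := by
  filter_upwards [Metric.ball_mem_nhds (0 : ℂ) (show 0 < 1 / (2 * D) by positivity)] with x hx
  exact (summable_of_norm_coeff_le hB hD h hx).hasSum

theorem IsRegularPart.sum {κ : ℕ} {ι : Type*} (s : Finset ι) {F : ι → GenSeries}
    {f : ι → ℂ → ℂ} (h : ∀ i ∈ s, IsRegularPart κ (F i) (f i)) :
    IsRegularPart κ (∑ i ∈ s, F i) fun x => ∑ i ∈ s, f i x := by
  filter_upwards [(Filter.eventually_all_finset s).2 h] with x hx
  simpa only [HahnSeries.coeff_sum, Finset.sum_div, Finset.sum_mul] using hasSum_sum hx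

end MomentPDE

/-! ### Proof of the theorem -/

open MomentPDE in
theorem mainTheorem9 (P : Polynomial (Polynomial ℂ)) (hP : P ≠ 0) (κ : ℕ) (hκ : 0 < κ)
    (n : ℕ) (pn : Fin n → ℕ) (lam : (j : Fin n) → Fin (pn j) → MomentPDE.Symbol)
    (mult : (j : Fin n) → Fin (pn j) → ℕ) (q : Fin n → ℚ)
    (hfac : MomentPDE.IsFactorization P κ pn lam mult q) :
    ∃ d : (j : Fin n) → (l : Fin (pn j)) → Fin (mult j l) → Fin P.natDegree → MomentPDE.Symbol,
      ∀ m : ℕ → ℝ, m 0 = 1 → (∀ i, 0 < m i) → MomentPDE.PreservesGevreyOrder m →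
      ∀ r : ℝ, 0 < r →
      ∀ φ : Fin P.natDegree → ℂ → ℂ, (∀ β, DifferentiableOn ℂ (φ β) (Metric.ball 0 r)) →
      ∀ u : ℕ → ℂ → ℂ, MomentPDE.IsNormalizedSolution P κ pn lam mult m r φ u →
      ∃ v : (j : Fin n) → (l : Fin (pn j)) → Fin (mult j l) → ℕ → ℂ → ℂ,
        (∃ ρ > (0 : ℝ),
          (∀ j l a i, DifferentiableOn ℂ (v j l a i) (Metric.ball 0 ρ)) ∧
          ∀ i, ∀ x ∈ Metric.ball (0 : ℂ) ρ,
            x ^ κ ∈ Metric.ball (0 : ℂ) r ∧ u i (x ^ κ) = ∑ j, ∑ l, ∑ a, v j l a i x) ∧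
        ∀ (j : Fin n) (l : Fin (pn j)) (a : Fin (mult j l)),
          MomentPDE.SolvesPseudo κ m
            ((MomentPDE.momentDeriv m - (lam j l).opT) ^ ((a : ℕ) + 1)) ((a : ℕ) + 1)
            (fun β => if β = (a : ℕ) then
              ((lam j l).op ^ (a : ℕ))
                (∑ γ, (d j l a γ).op (MomentPDE.ofGerm κ (φ γ))) else 0)
            (v j l a) ∧
          MomentPDE.IsGevreyInT (max (q j : ℝ) 0) (v j l a) ∧
          ∀ k : ℝ, 0 < k → (∀ β, MomentPDE.IsEntireOfGrowth k (φ β)) →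
            MomentPDE.IsGevreyInT (max (q j : ℝ) 0 * max (1 - 1 / k) 0) (v j l a) := by
  obtain ⟨d, hd⟩ := exists_decomposition_symbols hfac
  refine ⟨d, fun m hm0 hm hmG r hr φ hφ u hu => ?_⟩
  obtain ⟨⟨hholo, -, -⟩, U, hU, hUinit, hUreg⟩ := hu
  let F : (j : Fin n) → (l : Fin (pn j)) → Fin (mult j l) → GenSeries := fun j l a =>
    ∑ γ, (d j l a γ).op (ofGerm κ (φ γ))
  have hF : ∀ j l a, IsTame (1 / κ) (F j l a) := fun j l a =>
    isTame_sum_op (by positivity) _ fun γ => isTame_ofGerm_of_differentiableOn hκ hr (hφ γ)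
  have hUsum : U = ∑ j, ∑ l, ∑ a : Fin (mult j l),
      elementarySolution m (lam j l) a (F j l a) := by
    refine eq_sum_elementarySolution hm0 hm pn lam mult (g := initialData κ φ) (fun β hβ => ?_) hU
      (by rwa [hfac.sum_mult])
    rw [hfac.sum_mult] at hβ
    have key : ∀ j l (a : Fin (mult j l)),
        (β.choose a : ℂ) • ((lam j l).coeff ^ β * F j l a) =
          ∑ γ, ((β.choose a : ℕ) : LaurentSeries ℂ) * (lam j l).coeff ^ β *
            (d j l a γ).coeff * ofGerm κ (φ γ) := fun j l a => by
      rw [← HahnSeries.C_mul_eq_smul, map_natCast, ← mul_assoc, Finset.mul_sum]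
      exact Finset.sum_congr rfl fun γ _ => (mul_assoc _ _ _).symm
    simp only [key]
    -- Moving the sum over `γ` outside exposes the Vandermonde matrix times its inverse.
    calc _ = ∑ γ, (∑ j, ∑ l, ∑ a : Fin (mult j l), ((β.choose a : ℕ) : LaurentSeries ℂ) *
          (lam j l).coeff ^ β * (d j l a γ).coeff) * ofGerm κ (φ γ) := by
          simp only [Finset.sum_mul]
          rw [Finset.sum_comm]
          refine Finset.sum_congr rfl fun j _ => ?_
          rw [Finset.sum_comm]
          exact Finset.sum_congr rfl fun l _ => Finset.sum_comm
      _ = ∑ γ, (if (⟨β, hβ⟩ : Fin P.natDegree) = γ then 1 else 0) * ofGerm κ (φ γ) :=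
          Finset.sum_congr rfl fun γ _ => by rw [← hd ⟨β, hβ⟩ γ]
      _ = _ := by simp [initialData, hβ]
  have hbound : ∀ i : (Σ j : Fin n, Σ l : Fin (pn j), Fin (mult j l)), _ := fun i =>
    exists_norm_coeff_elementarySolution_le_of_hasPoleOrder hκ hm hmG (hfac.asymp i.1 i.2.1)
      zero_le_one le_rfl (hF i.1 i.2.1 i.2.2) i.2.2
  choose A B D hA hB hD hbd using hbound
  -- One ratio for all the finitely many pieces and all `i` gives one common disc.
  have hbd' : ∀ j l (a : Fin (mult j l)) i, ∃ M : ℝ, 0 ≤ M ∧ ∀ b : ℕ,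
      ‖(elementarySolution m (lam j l) a (F j l a) i).coeff (b : ℤ) /
        (Real.Gamma (1 + (b : ℝ) / κ) : ℂ)‖ ≤ M * (1 + ∑ i, D i) ^ b := fun j l a i => by
    have hle : D ⟨j, l, a⟩ ≤ 1 + ∑ i, D i := by
      have := Finset.single_le_sum (f := D) (fun i _ => (hD i).le) (Finset.mem_univ ⟨j, l, a⟩)
      linarith
    have h1 := hA ⟨j, l, a⟩
    have h2 := hB ⟨j, l, a⟩
    have h3 := hD ⟨j, l, a⟩
    refine ⟨B ⟨j, l, a⟩ * A ⟨j, l, a⟩ ^ i * (i.factorial : ℝ) ^ (max (q j : ℝ) 0 * 1),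
      by positivity, fun b => (hbd ⟨j, l, a⟩ i b).trans ?_⟩
    rw [mul_right_comm]
    gcongr
  have hD0 : 0 < 1 + ∑ i, D i := by
    have := Finset.sum_nonneg fun i (_ : i ∈ Finset.univ) => (hD i).le
    linarith
  set D₀ := 1 + ∑ i, D i
  have hreg : ∀ j l (a : Fin (mult j l)) i,
      IsRegularPart κ (elementarySolution m (lam j l) a (F j l a) i)
        (regularPart κ (elementarySolution m (lam j l) a (F j l a) i)) := fun j l a i => by
    obtain ⟨M, hM, h⟩ := hbd' j l a i
    exact isRegularPart_regularPart hM hD0 h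
  refine ⟨fun j l a i => regularPart κ (elementarySolution m (lam j l) a (F j l a) i), ?_, ?_⟩
  -- The bound `ρ ≤ 1` gives `‖x ^ κ‖ ≤ ‖x‖ < r`.
  · set ρ := min (1 / (2 * D₀)) (min 1 r) with hρ
    have hρ0 : 0 < ρ := by positivity
    have hdiff : ∀ j l (a : Fin (mult j l)) i, DifferentiableOn ℂ
        (regularPart κ (elementarySolution m (lam j l) a (F j l a) i)) (Metric.ball 0 ρ) := by
      intro j l a i
      obtain ⟨M, hM, h⟩ := hbd' j l a i
      exact (differentiableOn_tsum_of_norm_coeff_le hM hD0 h).mono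
        (Metric.ball_subset_ball (min_le_left _ _))
    have hmem : ∀ x ∈ Metric.ball (0 : ℂ) ρ, x ^ κ ∈ Metric.ball (0 : ℂ) r := by
      intro x hx
      rw [mem_ball_zero_iff] at hx ⊢
      have h1 : ‖x‖ ≤ 1 := hx.le.trans ((min_le_right _ _).trans (min_le_left _ _))
      have h2 : ‖x‖ < r := hx.trans_le ((min_le_right _ _).trans (min_le_right _ _))
      rw [norm_pow]
      exact (pow_le_of_le_one (norm_nonneg _) h1 hκ.ne').trans_lt h2
    refine ⟨ρ, hρ0, hdiff, fun i x hx => ⟨hmem x hx, ?_⟩⟩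
    have hleft : DifferentiableOn ℂ (fun x => u i (x ^ κ)) (Metric.ball 0 ρ) :=
      (hholo i).comp (by fun_prop) hmem
    have hright : DifferentiableOn ℂ (fun x => ∑ j, ∑ l, ∑ a : Fin (mult j l),
        regularPart κ (elementarySolution m (lam j l) a (F j l a) i) x) (Metric.ball 0 ρ) :=
      DifferentiableOn.fun_sum fun j _ => DifferentiableOn.fun_sum fun l _ =>
        DifferentiableOn.fun_sum fun a _ => hdiff j l a i
    -- The regular parts agree only on a neighbourhood of `0` that may depend on `i`; the identity
    -- theorem extends this to the fixed disc.
    refine (hleft.analyticOnNhd Metric.isOpen_ball).eqOn_of_preconnected_of_eventuallyEq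
      (hright.analyticOnNhd Metric.isOpen_ball) (convex_ball _ _).isPreconnected
      (Metric.mem_ball_self hρ0) ?_ hx
    have h1 : IsRegularPart κ (U i) fun x => ∑ j, ∑ l, ∑ a : Fin (mult j l),
        regularPart κ (elementarySolution m (lam j l) a (F j l a) i) x := by
      rw [hUsum]
      simp only [Finset.sum_apply]
      exact IsRegularPart.sum _ fun j _ => IsRegularPart.sum _ fun l _ =>
        IsRegularPart.sum _ fun a _ => hreg j l a i
    filter_upwards [hUreg i, h1] with x hx1 hx2
    exact hx1.unique hx2
  · refine fun j l a => ⟨⟨elementarySolution m (lam j l) a (F j l a),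
      factorOp_pow_succ_elementarySolution hm _ _ _, fun β hβ => ?_, hreg j l a⟩, ?_, ?_⟩
    · rw [momentDeriv_pow_elementarySolution_zero hm0 hm]
      beta_reduce
      split_ifs with h
      · rw [h, Nat.choose_self, Nat.cast_one, one_smul, Symbol.op_pow_apply]
      · rw [Nat.choose_eq_zero_of_lt (by omega), Nat.cast_zero]
        exact zero_smul ℂ ((lam j l).coeff ^ β * F j l a : GenSeries)
    · simpa only [mul_one] using isGevreyInT_regularPart_elementarySolution hκ hm hmG
        (hfac.asymp j l) zero_le_one le_rfl (hF j l a) a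
    · intro k hk hent
      -- The same pieces are estimated again, now with the smaller exponent that the growth of the
      -- data gives to `F`.
      refine isGevreyInT_regularPart_elementarySolution hκ hm hmG (hfac.asymp j l)
        (le_max_right _ _) (max_le ?_ zero_le_one) (isTame_sum_op (by positivity) _ fun γ =>
          isTame_ofGerm_of_isEntireOfGrowth hκ hk (hent γ)) a
      have : 0 < 1 / k := by positivity
      linarith

end
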